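/- Let $H,N\in\mathbb C^{n\times n}$ be Hermitian positive definite with $\|I-N\|_2\le\gamma<1$. Let $\mu_1\ge\dots\ge\mu_n$ be the eigenvalues of $H$ with orthonormal eigenvectors $z_1,\dots,z_n$, and let $1\le i\le s\le j\le n$. Put $$\widetilde{\mathcal Z}=\mathrm{span}\{z_{j-s+i+1},\dots,z_j\}^\perp,\qquad \widehat{\mathcal Z}=\mathrm{span}\{z_{j-s+1},\dots,z_{j-s+i}\}^\perp .$$ Ritz values of $H$ in a subspace are the eigenvalues of the orthogonal compression of $H$ to it, counted with multiplicity, and $Y\leftarrow\mathrm{RR}[H,k]\,\mathcal S$ means that the $k$ columns of $Y$ are orthonormal Ritz vectors of $H$ in $\mathcal S$ associated, in decreasing order, with the $k$ largest Ritz values of $H$ in $\mathcal S$. Let the columns of $Y^{(0)}\in\mathbb C^{n\times s}$ be orthonormal Ritz vectors of $H$ in $\mathrm{span}\{Y^{(0)}\}$ in decreasing order of the Ritz values, and for $\ell=0,1,2,\dots$ let $$\widetilde{\mathcal Y}^{(\ell)}=\mathrm{span}\{Y^{(\ell)}\}\cap\widetilde{\mathcal Z},\quad \widehat{\mathcal Y}^{(\ell)}=\mathrm{span}\{Y^{(\ell)}\}\cap\widehat{\mathcal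 Z},\quad U^{(\ell)}=Y^{(\ell)}\Theta^{(\ell)}+N\big(HY^{(\ell)}-Y^{(\ell)}\Theta^{(\ell)}\big),$$ $$\widetilde{\mathcal U}^{(\ell)}=\mathrm{span}\{U^{(\ell)}\}\cap\widetilde{\mathcal Z},\quad \widehat{\mathcal U}^{(\ell)}=\mathrm{span}\{U^{(\ell)}\}\cap\widehat{\mathcal Z},$$ $$\widetilde Y^{(\ell+\frac12)}\leftarrow\mathrm{RR}[H,\dim\widetilde{\mathcal Y}^{(\ell)}]\ \big(\widetilde{\mathcal Y}^{(\ell)}+\widetilde{\mathcal U}^{(\ell)}\big),\qquad \widehat Y^{(\ell+\frac12)}\leftarrow\mathrm{RR}[H,\dim\widehat{\mathcal Y}^{(\ell)}]\ \big(\widehat{\mathcal Y}^{(\ell)}+\widehat{\mathcal U}^{(\ell)}\big),$$ $$Y^{(\ell+1)}\leftarrow\mathrm{RR}[H,\tilde s]\ \mathrm{span}\{\widetilde Y^{(\ell+\frac12)},\widehat Y^{(\ell+\frac12)}\},\qquad \tilde s=\dim\mathrm{span}\{\widetilde Y^{(\ell+\frac12)},\widehat Y^{(\ell+\frac12)}\},$$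 where $\Theta^{(\ell)}$ is the diagonal matrix of the decreasingly ordered Ritz values of $H$ in $\mathrm{span}\{Y^{(\ell)}\}$. Assume that one of the following holds: 1. $j=s<n$, and the $s$-th largest Ritz value of $H$ in $\mathrm{span}\{Y^{(0)}\}$ is larger than $\mu_{s+1}$; or 2. $\dim\mathrm{span}\{Y^{(\ell)}\}=s$, $\dim\widetilde{\mathcal Y}^{(\ell)}=i$ and $\dim\widehat{\mathcal Y}^{(\ell)}=s-i$ for every $\ell$. Denote by $\tilde\theta'$ the $i$-th largest Ritz value of $H$ in $\widetilde{\mathcal Y}^{(\ell)}+\widetilde{\mathcal U}^{(\ell)}$. Then: (a) For every $\ell$, the matrix $U^{(\ell)}$ has $s$ columns and full rank $s$, and $\dim\widetilde{\mathcal U}^{(\ell)}\ge i$. (b) If $N=I$, then for every $\ell$, $\widetilde{\mathcal U}^{(\ell)}=H\widetilde{\mathcal Y}^{(\ell)}$, and there is a nonzero $\tilde y\in\widetilde{\mathcal Y}^{(\ell)}$ such that the largest Ritz value of $H$ in $\mathrm{span}\{\tilde y,H\tilde y\}$ does not exceed $\tilde\theta'$. (c) For every $\ell$, let $\widetilde U\in\mathbb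 C^{n\times i}$ have orthonormal columns with $\mathrm{span}\{\widetilde U\}\subseteq\widetilde{\mathcal U}^{(\ell)}$, and let the columns of $\widetilde Y\in\mathbb C^{n\times i}$ form an orthonormal basis of $\widetilde{\mathcal Y}^{(\ell)}$. If $\widetilde R=H\widetilde Y-\widetilde Y\widetilde Y^*H\widetilde Y$ has full rank $i$ and $$\big\|(H\widetilde Y-\widetilde U\widetilde U^*H\widetilde Y)(\widetilde R^*\widetilde R)^{-1/2}\big\|_2\le\tilde\gamma<1,$$ then there are nonzero vectors $\tilde y\in\mathrm{span}\{\widetilde Y\}$ and $\tilde u\in\mathrm{span}\{\widetilde U\}$ with $$\|H\tilde y-\tilde u\|_2\le\tilde\gamma\,\|H\tilde y-\mu(\tilde y)\tilde y\|_2,\qquad \mu(y)=\frac{y^*Hy}{y^*y},$$ such that the largest Ritz value of $H$ in $\mathrm{span}\{\tilde y,\tilde u\}$ does not exceed $\tilde\theta'$. -/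

import Mathlib

open scoped Matrix Matrix.Norms.L2Operator ComplexOrder

/-- The operator `x ↦ H x` on `ℂⁿ` with its Euclidean inner product. -/
noncomputable abbrev matOp {n : ℕ} (H : Matrix (Fin n) (Fin n) ℂ) :
    EuclideanSpace ℂ (Fin n) →L[ℂ] EuclideanSpace ℂ (Fin n) :=
  Matrix.toEuclideanCLM (n := Fin n) (𝕜 := ℂ) H

/-- The `a`-th column of a matrix, as a vector of Euclidean space. -/
noncomputable def colVec {n k : ℕ} (Y : Matrix (Fin n) (Fin k) ℂ) (a : Fin k) :
    EuclideanSpace ℂ (Fin n) :=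
  WithLp.toLp 2 fun r => Y r a

/-- `span{Y}`: the column space of a matrix. -/
noncomputable def colSpan {n k : ℕ} (Y : Matrix (Fin n) (Fin k) ℂ) :
    Submodule ℂ (EuclideanSpace ℂ (Fin n)) :=
  Submodule.span ℂ (Set.range (colVec Y))

/-- The compression `P_S H|_S` of `H` to a subspace `S`; its eigenvalues and eigenvectors are the
Ritz values and Ritz vectors of `H` in `S`. -/
noncomputable def compression {n : ℕ} (H : Matrix (Fin n) (Fin n) ℂ)
    (S : Submodule ℂ (EuclideanSpace ℂ (Fin n))) : S →ₗ[ℂ] S :=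
  (S.orthogonalProjectionOnto : EuclideanSpace ℂ (Fin n) →ₗ[ℂ] S) ∘ₗ
    (matOp H : EuclideanSpace ℂ (Fin n) →ₗ[ℂ] EuclideanSpace ℂ (Fin n)) ∘ₗ S.subtype

theorem matOp_isSymmetric {n : ℕ} {H : Matrix (Fin n) (Fin n) ℂ} (hH : H.IsHermitian) :
    (matOp H : EuclideanSpace ℂ (Fin n) →ₗ[ℂ] EuclideanSpace ℂ (Fin n)).IsSymmetric := by
  have h := Matrix.isSymmetric_toEuclideanLin_iff.symm.1 hH
  exact h

theorem compression_isSymmetric {n : ℕ} {H : Matrix (Fin n) (Fin n) ℂ} (hH : H.IsHermitian)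
    (S : Submodule ℂ (EuclideanSpace ℂ (Fin n))) : LinearMap.IsSymmetric (𝕜 := ℂ) (E := S) (compression H S) := by
  intro x y
  have h := matOp_isSymmetric hH x y
  simpa [compression] using h

/-- The `k`-th largest Ritz value (`k = 1, …, dim S`, counted with multiplicity) of the Hermitian
matrix `H` in the subspace `S`; the value for other `k` is irrelevant. -/
noncomputable def ritzValue {n : ℕ} {H : Matrix (Fin n) (Fin n) ℂ} (hH : H.IsHermitian)
    (S : Submodule ℂ (EuclideanSpace ℂ (Fin n))) (k : ℕ) : ℝ :=
  if h : 1 ≤ k ∧ k ≤ Module.finrank ℂ S then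
    (compression_isSymmetric hH S).eigenvalues rfl ⟨k - 1, by omega⟩
  else 0

/-- `Y ← RR[H, k] S`: the columns of the `n × k` matrix `Y` are orthonormal Ritz vectors of `H`
in `S`, associated in this order with the `k` largest Ritz values of `H` in `S`. -/
structure IsRayleighRitz {n : ℕ} {H : Matrix (Fin n) (Fin n) ℂ} (hH : H.IsHermitian)
    (S : Submodule ℂ (EuclideanSpace ℂ (Fin n))) {k : ℕ} (Y : Matrix (Fin n) (Fin k) ℂ) :
    Prop where
  mem : ∀ a, colVec Y a ∈ S
  orthonormal : Orthonormal ℂ (colVec Y)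
  ritz : ∀ a, compression H S ⟨colVec Y a, mem a⟩ =
    ((ritzValue hH S (a + 1) : ℝ) : ℂ) • (⟨colVec Y a, mem a⟩ : S)

/-- The diagonal matrix `Θ_Y` of the Ritz values of `H` in `span{Y}`, in decreasing order. -/
noncomputable def ritzDiag {n : ℕ} {H : Matrix (Fin n) (Fin n) ℂ} (hH : H.IsHermitian) {k : ℕ}
    (Y : Matrix (Fin n) (Fin k) ℂ) : Matrix (Fin k) (Fin k) ℂ :=
  Matrix.diagonal fun a => ((ritzValue hH (colSpan Y) (a + 1) : ℝ) : ℂ)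

/-- `U = Y Θ_Y + N (H Y - Y Θ_Y)`. -/
noncomputable def trialMatrix {n : ℕ} {H : Matrix (Fin n) (Fin n) ℂ} (hH : H.IsHermitian)
    (N : Matrix (Fin n) (Fin n) ℂ) {k : ℕ} (Y : Matrix (Fin n) (Fin k) ℂ) :
    Matrix (Fin n) (Fin k) ℂ :=
  Y * ritzDiag hH Y + N * (H * Y - Y * ritzDiag hH Y)

/-- A run of the split iteration with respect to the subspaces `Zt` (`𝒵̃`) and `Zh` (`𝒵̂`),
started with block size `s`. The number of columns of the iterate may vary from step to step. -/
structure SplitIteration {n : ℕ} {H : Matrix (Fin n) (Fin n) ℂ} (hH : H.IsHermitian)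
    (N : Matrix (Fin n) (Fin n) ℂ) (Zt Zh : Submodule ℂ (EuclideanSpace ℂ (Fin n)))
    (s : ℕ) where
  /-- the number of columns of the iterate -/
  cols : ℕ → ℕ
  /-- the iterates `Y^(ℓ)` -/
  Y : ∀ l : ℕ, Matrix (Fin n) (Fin (cols l)) ℂ
  /-- the partial iterates `Ỹ^(ℓ+1/2)`, with `dim 𝒴̃^(ℓ)` columns -/
  Yt : ∀ l : ℕ, Matrix (Fin n)
    (Fin (Module.finrank ℂ (colSpan (Y l) ⊓ Zt : Submodule ℂ (EuclideanSpace ℂ (Fin n))))) ℂ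
  /-- the partial iterates `Ŷ^(ℓ+1/2)`, with `dim 𝒴̂^(ℓ)` columns -/
  Yh : ∀ l : ℕ, Matrix (Fin n)
    (Fin (Module.finrank ℂ (colSpan (Y l) ⊓ Zh : Submodule ℂ (EuclideanSpace ℂ (Fin n))))) ℂ
  cols_zero : cols 0 = s
  init : IsRayleighRitz hH (colSpan (Y 0)) (Y 0)
  partial_t : ∀ l, IsRayleighRitz hH
    ((colSpan (Y l) ⊓ Zt) ⊔ (colSpan (trialMatrix hH N (Y l)) ⊓ Zt)) (Yt l)
  partial_h : ∀ l, IsRayleighRitz hH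
    ((colSpan (Y l) ⊓ Zh) ⊔ (colSpan (trialMatrix hH N (Y l)) ⊓ Zh)) (Yh l)
  cols_succ : ∀ l, cols (l + 1) =
    Module.finrank ℂ (colSpan (Yt l) ⊔ colSpan (Yh l) : Submodule ℂ (EuclideanSpace ℂ (Fin n)))
  next : ∀ l, IsRayleighRitz hH (colSpan (Yt l) ⊔ colSpan (Yh l)) (Y (l + 1))

namespace SplitIteration

variable {n : ℕ} {H : Matrix (Fin n) (Fin n) ℂ} {hH : H.IsHermitian}
  {N : Matrix (Fin n) (Fin n) ℂ} {Zt Zh : Submodule ℂ (EuclideanSpace ℂ (Fin n))} {s : ℕ}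

/-- `𝒴̃^(ℓ) = span{Y^(ℓ)} ∩ 𝒵̃` -/
noncomputable def spaceYt (I : SplitIteration hH N Zt Zh s) (l : ℕ) :
    Submodule ℂ (EuclideanSpace ℂ (Fin n)) :=
  colSpan (I.Y l) ⊓ Zt

/-- `𝒴̂^(ℓ) = span{Y^(ℓ)} ∩ 𝒵̂` -/
noncomputable def spaceYh (I : SplitIteration hH N Zt Zh s) (l : ℕ) :
    Submodule ℂ (EuclideanSpace ℂ (Fin n)) :=
  colSpan (I.Y l) ⊓ Zh

/-- `U^(ℓ) = Y^(ℓ) Θ^(ℓ) + N (H Y^(ℓ) - Y^(ℓ) Θ^(ℓ))` -/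
noncomputable def U (I : SplitIteration hH N Zt Zh s) (l : ℕ) :
    Matrix (Fin n) (Fin (I.cols l)) ℂ :=
  trialMatrix hH N (I.Y l)

/-- `𝒰̃^(ℓ) = span{U^(ℓ)} ∩ 𝒵̃` -/
noncomputable def spaceUt (I : SplitIteration hH N Zt Zh s) (l : ℕ) :
    Submodule ℂ (EuclideanSpace ℂ (Fin n)) :=
  colSpan (I.U l) ⊓ Zt

end SplitIteration

/-- `span{z_{p+1}, …, z_q}^⊥`, for vectors `z_1, …, z_n` (in Lean `z 0, …, z (n-1)`). -/
noncomputable def orthSpan {n : ℕ} (z : Fin n → EuclideanSpace ℂ (Fin n)) (p q : ℕ) :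
    Submodule ℂ (EuclideanSpace ℂ (Fin n)) :=
  (Submodule.span ℂ {v | ∃ a : Fin n, p ≤ (a : ℕ) ∧ (a : ℕ) < q ∧ v = z a})ᗮ

open scoped MatrixOrder in
/-- `P^{-1/2}` for a positive definite matrix `P`: the positive square root of `P⁻¹`. -/
noncomputable def invSqrt {k : ℕ} (P : Matrix (Fin k) (Fin k) ℂ) : Matrix (Fin k) (Fin k) ℂ :=
  CFC.sqrt P⁻¹

/-! Under the first hypothesis put `ν = μ_{s+1}`. The Rayleigh quotient is at most `ν` on the
intersection of the two orthogonal complements, and above `ν` on the initial space, hence on its two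
parts. By Courant–Fischer the Ritz vectors kept from the larger trial spaces preserve the bound, so
the partial iterates meet the opposite complement trivially and all dimensions persist
(`finrank_eq_of_shiftedForm_pos`). Thus the second hypothesis holds in either case. Full rank in (a)
follows because `U c` differs from `H Y c` by less than the norm of the latter; the rest of (a) is a
dimension count.

For (b) and (c), the vectors of the trial space orthogonal to its first `i - 1` Ritz vectors have
Rayleigh quotient at most the `i`-th Ritz value `θ`. A plane inside this kernel suffices. In (b) the
kernel condition passes from `y` to `H y`, so counting dimensions gives `y`.

In (c) it does not pass to `u`, and the argument is topological (`exists_plane_shiftedForm_nonpos`).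
Suppose that every plane spanned by `Y c` and `G c`, where `G c` projects `H Y c` onto the span of
`U`, has a vector with Rayleigh quotient above `θ`. Then there is a continuous bounded `κ` on the
unit sphere such that `κ c • Y c + G c` is such a vector. The kernel conditions on `t • Y c + G c`
form a pencil with `i - 1` rows and `i` columns, solved by a nowhere zero polynomial vector `c(t)`.
A fixed point of `t ↦ κ (c t)` puts the vector in the kernel, a contradiction. -/

/-! ### Topological and algebraic tools: planar fixed points and rectangular pencils. -/

/-- A bounded continuous self-map of the complex plane has a fixed point. -/
theorem Complex.exists_fixed_point_of_bounded {f : ℂ → ℂ} (hf : Continuous f) {M : ℝ}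
    (hM : ∀ t, ‖f t‖ ≤ M) : ∃ t, f t = t := by
  by_contra! hne
  have hM0 : 0 ≤ M := (norm_nonneg _).trans (hM 0)
  have hcov := Complex.isCoveringMapOn_exp
  have h0 : ∀ t, t - f t ≠ 0 := fun t => sub_ne_zero.2 (hne t).symm
  -- The plane is simply connected, so the zero-free map `t - f t` has a continuous logarithm `F`.
  obtain ⟨F, ⟨-, hF⟩, -⟩ := hcov.existsUnique_continuousMap_lifts
    (f := ⟨fun t => t - f t, by fun_prop⟩) (a₀ := 0) (e₀ := Complex.log (0 - f 0))
    (by simpa using Complex.exp_log (h0 0)) (fun t => h0 t)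
  have hF' : ∀ t, Complex.exp (F t) = t - f t := fun t => congrFun hF t
  set w : ℝ → ℂ := fun x => (M + 1 : ℝ) * Complex.exp (x * Complex.I) with hw
  have hwc : Continuous w := by fun_prop
  have hwn : ∀ x, ‖w x‖ = M + 1 := fun x => by
    simp only [hw, norm_mul, Complex.norm_exp_ofReal_mul_I, mul_one, Complex.norm_real,
      Real.norm_eq_abs]
    exact abs_of_nonneg (by linarith)
  have hw0 : ∀ x, w x ≠ 0 := fun x => norm_ne_zero_iff.1 (by rw [hwn]; linarith)
  -- On the circle of radius `M + 1` this quotient is within distance less than `1` of `1`, so its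
  -- principal logarithm is continuous.
  have hslit : ∀ x, (w x - f (w x)) / w x ∈ Complex.slitPlane := fun x => by
    have h1 : (w x - f (w x)) / w x = 1 + -(f (w x) / w x) := by field_simp [hw0 x]; ring
    rw [h1]
    apply Complex.mem_slitPlane_of_norm_lt_one
    rw [norm_neg, norm_div, hwn, div_lt_one (by linarith)]
    linarith [hM (w x)]
  -- `D` compares two logarithms of `w x - f (w x)`, so `exp D = 1` and `D` is constant. Yet after
  -- one turn only the last term has changed, by `2πi`.
  set D : ℝ → ℂ := fun x => F (w x) - Complex.log ((w x - f (w x)) / w x)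
    - Real.log (M + 1) - x * Complex.I with hD
  have hDc : Continuous D := by
    have h1 : Continuous fun x => Complex.log ((w x - f (w x)) / w x) :=
      Continuous.clog (by
        apply Continuous.div _ hwc hw0
        exact hwc.sub (hf.comp hwc)) hslit
    have h2 : Continuous fun x => F (w x) := F.continuous.comp hwc
    exact ((h2.sub h1).sub continuous_const).sub (by fun_prop)
  have hDe : ∀ x, Complex.exp (D x) = 1 := fun x => by
    simp only [hD, Complex.exp_sub, hF', Complex.exp_log (Complex.slitPlane_ne_zero (hslit x)),
      ← Complex.ofReal_exp]
    rw [Real.exp_log (by linarith), div_div_cancel₀ (h0 _), hw]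
    have : ((M + 1 : ℝ) : ℂ) ≠ 0 := Complex.ofReal_ne_zero.2 (by linarith)
    field_simp
  have huniq := (hcov.existsUnique_continuousMap_lifts (A := ℝ)
    (f := ⟨fun _ => 1, continuous_const⟩) (a₀ := 0) (e₀ := D 0) (by simpa using hDe 0)
    (fun _ => by simp)).unique (y₁ := ⟨D, hDc⟩) (y₂ := ⟨fun _ => D 0, continuous_const⟩)
    ⟨rfl, funext fun x => by simpa using hDe x⟩ ⟨rfl, funext fun x => by simpa using hDe 0⟩
  have hcst : D (2 * Real.pi) = D 0 := DFunLike.congr_fun huniq (2 * Real.pi)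
  have hww : w (2 * Real.pi) = w 0 := by simp [hw]
  simp only [hD, hww] at hcst
  simp at hcst

/-- A linear pencil `X • A + B` with fewer rows than columns has a polynomial kernel vector without
zeros. -/
theorem exists_polynomial_kernel_vector {p q : ℕ} (hpq : p < q) (A B : Matrix (Fin p) (Fin q) ℂ) :
    ∃ v : Fin q → Polynomial ℂ, (∀ t : ℂ, (fun a => (v a).eval t) ≠ 0) ∧
      ∀ t : ℂ, (t • A + B) *ᵥ (fun a => (v a).eval t) = 0 := by
  classical
  -- Padding the pencil with zero rows makes it square and singular over `ℂ[X]`.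
  let M : Matrix (Fin q) (Fin q) (Polynomial ℂ) := fun r c =>
    if h : (r : ℕ) < p then
      Polynomial.X * Polynomial.C (A ⟨r, h⟩ c) + Polynomial.C (B ⟨r, h⟩ c) else 0
  have hdet : M.det = 0 := by
    apply Matrix.det_eq_zero_of_row_eq_zero (⟨p, hpq⟩ : Fin q)
    intro c
    simp [M]
  obtain ⟨v, hv0, hv⟩ := Matrix.exists_mulVec_eq_zero_iff.2 hdet
  let _ : NormalizedGCDMonoid (Polynomial ℂ) :=
    Classical.choice inferInstance
  -- After division by the gcd of the entries, a common zero `t` would make `X - t` divide `1`.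
  obtain ⟨g, hg, hg1⟩ := Finset.extract_gcd v (s := Finset.univ) ⟨⟨p, hpq⟩, Finset.mem_univ _⟩
  have hd0 : Finset.univ.gcd v ≠ 0 := fun h => by
    rw [Finset.gcd_eq_zero_iff] at h
    exact hv0 (funext fun a => h a (Finset.mem_univ _))
  have hMg : M *ᵥ g = 0 := by
    have h1 : v = Finset.univ.gcd v • g := funext fun a => hg a (Finset.mem_univ _)
    rw [h1, Matrix.mulVec_smul] at hv
    exact (smul_eq_zero.1 hv).resolve_left hd0
  refine ⟨g, fun t ht => ?_, fun t => ?_⟩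
  · have h1 : (Polynomial.X - Polynomial.C t) ∣ Finset.univ.gcd g :=
      Finset.dvd_gcd fun a _ => Polynomial.dvd_iff_isRoot.2 (congrFun ht a)
    rw [hg1] at h1
    exact Polynomial.not_isUnit_X_sub_C t (isUnit_of_dvd_one h1)
  · funext r
    have h1 := congrArg (Polynomial.eval t) (congrFun hMg ⟨r, r.2.trans hpq⟩)
    simpa [M, Matrix.mulVec, dotProduct, Polynomial.eval_finsetSum, mul_comm t] using h1

/-! ### Shifted quadratic forms and the existence of a good plane. -/

section ShiftedForm

variable {E : Type*} [NormedAddCommGroup E] [InnerProductSpace ℂ E]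

/-- The real quadratic form `v ↦ v^* A v - t v^* v`. -/
noncomputable def shiftedForm (A : E →L[ℂ] E) (t : ℝ) (v : E) : ℝ :=
  (inner ℂ v (A v)).re - t * ‖v‖ ^ 2

theorem shiftedForm_smul (A : E →L[ℂ] E) (t : ℝ) (a : ℂ) (v : E) :
    shiftedForm A t (a • v) = ‖a‖ ^ 2 * shiftedForm A t v := by
  have h : a * (starRingEnd ℂ a * inner ℂ v (A v)) = ((‖a‖ ^ 2 : ℝ) : ℂ) * inner ℂ v (A v) := by
    rw [mul_left_comm, ← mul_assoc, ← Complex.normSq_eq_conj_mul_self, Complex.normSq_eq_norm_sq]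
  simp only [shiftedForm, map_smul, inner_smul_left, inner_smul_right, norm_smul]
  rw [h, Complex.re_ofReal_mul]
  ring

theorem shiftedForm_anti (A : E →L[ℂ] E) (v : E) : Antitone fun t => shiftedForm A t v := by
  intro t t' h
  have := mul_le_mul_of_nonneg_right h (sq_nonneg ‖v‖)
  simp only [shiftedForm]
  linarith

theorem shiftedForm_smul_add {A : E →L[ℂ] E} (hA : (A : E →ₗ[ℂ] E).IsSymmetric) (t : ℝ) (k : ℂ)
    (x g : E) : shiftedForm A t (k • x + g) = ‖k‖ ^ 2 * shiftedForm A t x +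
      2 * (starRingEnd ℂ k * inner ℂ x (A g - (t : ℂ) • g)).re + shiftedForm A t g := by
  have h1 : inner ℂ g (A x) = starRingEnd ℂ (inner ℂ x (A g)) := by
    rw [inner_conj_symm]; exact (hA g x).symm
  have h2 : ‖k • x + g‖ ^ 2 = ‖k‖ ^ 2 * ‖x‖ ^ 2 + 2 * (starRingEnd ℂ k * inner ℂ x g).re
      + ‖g‖ ^ 2 := by
    rw [norm_add_sq (𝕜 := ℂ), norm_smul, inner_smul_left]
    simp [mul_pow]
  have h3 := shiftedForm_smul A t k x
  have h4 : inner ℂ (k • x + g) (A (k • x + g)) = inner ℂ (k • x) (A (k • x))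
      + starRingEnd ℂ k * inner ℂ x (A g) + starRingEnd ℂ (starRingEnd ℂ k * inner ℂ x (A g))
      + inner ℂ g (A g) := by
    simp only [map_add, map_smul, inner_add_left, inner_add_right, inner_smul_left,
      inner_smul_right, h1, map_mul, Complex.conj_conj]
    ring
  simp only [shiftedForm] at h3 ⊢
  rw [h2, h4]
  simp only [Complex.add_re, Complex.conj_re, inner_sub_right, inner_smul_right, mul_sub,
    Complex.sub_re]
  have h5 : (starRingEnd ℂ k * ((t : ℂ) * inner ℂ x g)).re = t * (starRingEnd ℂ k * inner ℂ x g).re := by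
    rw [mul_left_comm, Complex.re_ofReal_mul]
  rw [h5, norm_smul] at *
  linear_combination h3

/-- Completing the square: when the form is negative at `x`, its maximum over `k • x + g` is
attained at an explicit `k`. -/
theorem shiftedForm_smul_add_le {A : E →L[ℂ] E} (hA : (A : E →ₗ[ℂ] E).IsSymmetric) (t : ℝ)
    {x : E} (hx : shiftedForm A t x < 0) (g : E) (a : ℂ) :
    shiftedForm A t (a • x + g) ≤ shiftedForm A t
      ((inner ℂ x (A g - (t : ℂ) • g) / ((-shiftedForm A t x : ℝ) : ℂ)) • x + g) := by
  set D := -shiftedForm A t x with hD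
  have hD0 : 0 < D := by linarith
  set k := inner ℂ x (A g - (t : ℂ) • g) / (D : ℂ) with hk
  have hc : inner ℂ x (A g - (t : ℂ) • g) = k * D := by
    rw [hk, div_mul_cancel₀]
    exact Complex.ofReal_ne_zero.2 hD0.ne'
  rw [shiftedForm_smul_add hA, shiftedForm_smul_add hA, hc,
    show shiftedForm A t x = -D by linarith]
  have h1 : (starRingEnd ℂ a * (k * D)).re = (starRingEnd ℂ a * k).re * D := by
    rw [← mul_assoc, Complex.re_mul_ofReal]
  have h2 : (starRingEnd ℂ k * (k * D)).re = ‖k‖ ^ 2 * D := by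
    rw [← mul_assoc, ← Complex.normSq_eq_conj_mul_self, Complex.normSq_eq_norm_sq,
      ← Complex.ofReal_mul, Complex.ofReal_re]
  have h3 : 0 ≤ ‖a‖ ^ 2 - 2 * (starRingEnd ℂ a * k).re + ‖k‖ ^ 2 := by
    have h4 := norm_sub_sq (𝕜 := ℂ) a k
    have h5 : RCLike.re (inner ℂ a k) = (starRingEnd ℂ a * k).re := by
      simp [mul_comm]
    rw [h5] at h4
    rw [← h4]; positivity
  rw [h1, h2]
  nlinarith [mul_nonneg h3 hD0.le]

theorem continuous_shiftedForm (A : E →L[ℂ] E) (t : ℝ) : Continuous (shiftedForm A t) := by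
  unfold shiftedForm
  exact (Complex.continuous_re.comp (continuous_id.inner A.continuous)).sub (by fun_prop)

/-- In the span of `x` and `g`, if `x` is not stationary in the direction `g`, a positive value of
the form can be reached with a shift above the Rayleigh quotient of `x`. -/
theorem exists_shift_of_pos {A : E →L[ℂ] E} (hA : (A : E →ₗ[ℂ] E).IsSymmetric) {θ : ℝ} {x g : E}
    (hx : x ≠ 0)
    (hxg : ∀ m : ℝ, shiftedForm A m x = 0 → inner ℂ x (A g - (m : ℂ) • g) ≠ 0)
    (h : ∃ a b : ℂ, 0 < shiftedForm A θ (a • x + b • g)) :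
    ∃ t : ℝ, θ < t ∧ shiftedForm A t x < 0 ∧ ∃ a : ℂ, 0 < shiftedForm A t (a • x + g) := by
  have hxn : 0 < ‖x‖ ^ 2 := by positivity
  obtain ⟨m, hθm, hm, a, b, hab⟩ : ∃ m : ℝ, θ ≤ m ∧ shiftedForm A m x ≤ 0 ∧
      ∃ a b : ℂ, 0 < shiftedForm A m (a • x + b • g) := by
    -- If the form is already positive at `x`, the shift is raised to the Rayleigh quotient of `x`;
    -- there the nonzero cross term with `g` still yields positive values.
    rcases le_or_gt (shiftedForm A θ x) 0 with h0 | h0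
    · exact ⟨θ, le_rfl, h0, h⟩
    · set m := (inner ℂ x (A x)).re / ‖x‖ ^ 2 with hm
      have hm0 : shiftedForm A m x = 0 := by
        simp only [shiftedForm, hm]; field_simp; ring
      refine ⟨m, ?_, hm0.le, ?_⟩
      · rw [hm, le_div_iff₀ hxn]
        simp only [shiftedForm] at h0
        linarith
      · have hk := hxg m hm0
        set k := inner ℂ x (A g - (m : ℂ) • g) with hkdef
        have hkn : 0 < ‖k‖ ^ 2 := by positivity
        refine ⟨(((|shiftedForm A m g| + 1) / ‖k‖ ^ 2 : ℝ) : ℂ) * k, 1, ?_⟩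
        rw [one_smul, shiftedForm_smul_add hA, hm0, ← hkdef, map_mul, Complex.conj_ofReal,
          mul_assoc, ← Complex.normSq_eq_conj_mul_self, Complex.normSq_eq_norm_sq,
          ← Complex.ofReal_mul, Complex.ofReal_re, div_mul_cancel₀ _ hkn.ne']
        linarith [neg_abs_le (shiftedForm A m g), abs_nonneg (shiftedForm A m g)]
  set v := a • x + b • g with hv
  -- Small enough to cost `v` less than half of its value, yet enough to make the form strictly
  -- negative at `x`.
  set ε := shiftedForm A m v / (2 * (‖v‖ ^ 2 + 1)) with hε
  have hε0 : 0 < ε := by positivity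
  have hv1 : 0 < shiftedForm A (m + ε) v := by
    have h1 : ε * (2 * (‖v‖ ^ 2 + 1)) = shiftedForm A m v := by
      rw [hε]; field_simp
    have h2 : shiftedForm A (m + ε) v = shiftedForm A m v - ε * ‖v‖ ^ 2 := by
      simp only [shiftedForm]; ring
    rw [h2]
    nlinarith [mul_nonneg hε0.le (sq_nonneg ‖v‖)]
  have hx1 : shiftedForm A (m + ε) x < 0 := by
    have h2 : shiftedForm A (m + ε) x = shiftedForm A m x - ε * ‖x‖ ^ 2 := by
      simp only [shiftedForm]; ring
    rw [h2]
    nlinarith [mul_pos hε0 hxn]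
  refine ⟨m + ε, by linarith, hx1, ?_⟩
  have hb : b ≠ 0 := by
    rintro rfl
    rw [hv, zero_smul, add_zero, shiftedForm_smul] at hv1
    nlinarith [sq_nonneg ‖a‖]
  refine ⟨b⁻¹ * a, ?_⟩
  have h1 : (b⁻¹ * a) • x + g = b⁻¹ • v := by
    rw [hv, smul_add, smul_smul, smul_smul, inv_mul_cancel₀ hb, one_smul]
  rw [h1, shiftedForm_smul]
  have : b⁻¹ ≠ 0 := inv_ne_zero hb
  positivity

/-- If the form `shiftedForm A θ` is nonpositive on the common kernel of fewer functionals than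
the dimension of the parameter space, then it is nonpositive on one of the planes spanned by
`Y c` and `G c`, provided that no `Y c` is stationary for the Rayleigh quotient in the direction
`G c`. -/
theorem exists_plane_shiftedForm_nonpos {p k : ℕ} (hpk : p < k) {A : E →L[ℂ] E}
    (hA : (A : E →ₗ[ℂ] E).IsSymmetric) (Y G : EuclideanSpace ℂ (Fin k) →L[ℂ] E)
    (hY : ∀ c, c ≠ 0 → Y c ≠ 0)
    (hYG : ∀ c, c ≠ 0 → ∀ m : ℝ, shiftedForm A m (Y c) = 0 →
      inner ℂ (Y c) (A (G c) - (m : ℂ) • G c) ≠ 0)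
    (P : E →ₗ[ℂ] (Fin p → ℂ)) (θ : ℝ)
    (hP : ∀ (c) (a : ℂ), P (a • Y c + G c) = 0 → shiftedForm A θ (a • Y c + G c) ≤ 0) :
    ∃ c, c ≠ 0 ∧ ∀ a b : ℂ, shiftedForm A θ (a • Y c + b • G c) ≤ 0 := by
  by_contra! hcon
  let S := Metric.sphere (0 : EuclideanSpace ℂ (Fin k)) 1
  have hS0 : ∀ c : S, (c : EuclideanSpace ℂ (Fin k)) ≠ 0 := fun c =>
    ne_zero_of_mem_unit_sphere c
  have hcompact : CompactSpace S := isCompact_iff_compactSpace.1 (isCompact_sphere _ _)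
  -- The admissible shifts form an interval, because the form decreases in `t`, and a single shift
  -- stays admissible near `c`. A partition of unity then selects a continuous `τ`.
  let T : S → Set ℝ := fun c => {t | θ < t ∧ shiftedForm A t (Y c) < 0 ∧
    ∃ a : ℂ, 0 < shiftedForm A t (a • Y c + G c)}
  have hYc : Continuous fun c : S => Y (c : EuclideanSpace ℂ (Fin k)) :=
    Y.continuous.comp continuous_subtype_val
  have hGc : Continuous fun c : S => G (c : EuclideanSpace ℂ (Fin k)) :=
    G.continuous.comp continuous_subtype_val
  have hTconv : ∀ c, Convex ℝ (T c) := by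
    intro c
    apply Set.OrdConnected.convex
    refine ⟨fun t ht t' ht' r hr => ?_⟩
    obtain ⟨h1, h2, -⟩ := ht
    obtain ⟨-, -, a, h3⟩ := ht'
    exact ⟨h1.trans_le hr.1, (shiftedForm_anti A _ hr.1).trans_lt h2, a,
      h3.trans_le (shiftedForm_anti A _ hr.2)⟩
  have hTloc : ∀ c, ∃ t, ∀ᶠ c' in nhds c, t ∈ T c' := by
    intro c
    obtain ⟨t, h1, h2, a, h3⟩ := exists_shift_of_pos hA (hY c (hS0 c)) (hYG c (hS0 c))
      (hcon c (hS0 c))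
    refine ⟨t, ?_⟩
    have e2 := (((continuous_shiftedForm A t).comp hYc).tendsto c).eventually_lt_const h2
    have e3 := (((continuous_shiftedForm A t).comp
      ((hYc.const_smul a).add hGc)).tendsto c).eventually_const_lt h3
    filter_upwards [e2, e3] with c' h2' h3'
    exact ⟨h1, h2', a, h3'⟩
  obtain ⟨τ, hτ⟩ := exists_continuous_forall_mem_convex_of_local_const hTconv hTloc
  -- The maximizer from completing the square. It depends continuously on `c`, as negativity at `Y
  -- c` keeps the denominator nonzero.
  let κ : S → ℂ := fun c => inner ℂ (Y c) (A (G c) - (τ c : ℂ) • G c) /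
    ((-shiftedForm A (τ c) (Y c) : ℝ) : ℂ)
  have hκc : Continuous κ := by
    have hτc : Continuous fun c => ((τ c : ℝ) : ℂ) := Complex.continuous_ofReal.comp τ.continuous
    refine Continuous.div (hYc.inner ((A.continuous.comp hGc).sub (hτc.smul hGc)))
      (Complex.continuous_ofReal.comp (Continuous.neg ?_)) fun c => ?_
    · exact (Complex.continuous_re.comp (hYc.inner (A.continuous.comp hYc))).sub
        (τ.continuous.mul (hYc.norm.pow 2))
    · exact Complex.ofReal_ne_zero.2 (by linarith [(hτ c).2.1])
  have hκpos : ∀ c, 0 < shiftedForm A θ (κ c • Y c + G c) := fun c => by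
    obtain ⟨h1, h2, a, h3⟩ := hτ c
    exact (h3.trans_le (shiftedForm_smul_add_le hA _ h2 _ a)).trans_le
      (shiftedForm_anti A _ h1.le)
  obtain ⟨M, hM⟩ := isCompact_univ.exists_bound_of_continuousOn hκc.continuousOn
  let e := (WithLp.linearEquiv 2 ℂ (Fin k → ℂ)).symm
  let PY : (Fin k → ℂ) →ₗ[ℂ] (Fin p → ℂ) := P ∘ₗ (Y : _ →ₗ[ℂ] E) ∘ₗ e.toLinearMap
  let PG : (Fin k → ℂ) →ₗ[ℂ] (Fin p → ℂ) := P ∘ₗ (G : _ →ₗ[ℂ] E) ∘ₗ e.toLinearMap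
  obtain ⟨v, hv0, hv⟩ := exists_polynomial_kernel_vector hpk
    (LinearMap.toMatrix' PY) (LinearMap.toMatrix' PG)
  let u : ℂ → EuclideanSpace ℂ (Fin k) := fun t => WithLp.toLp 2 fun a => (v a).eval t
  have hu0 : ∀ t, u t ≠ 0 := fun t h => hv0 t (by
    have := congrArg (WithLp.ofLp) h
    simpa [u] using this)
  have huc : Continuous u := by
    refine (PiLp.continuous_toLp 2 _).comp (continuous_pi fun a => (v a).continuous)
  have huP : ∀ t, P (t • Y (u t) + G (u t)) = 0 := fun t => by
    have h := hv t
    rw [Matrix.add_mulVec, Matrix.smul_mulVec, LinearMap.toMatrix'_mulVec,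
      LinearMap.toMatrix'_mulVec] at h
    rw [map_add, map_smul]
    exact h
  -- Normalizing is possible because `u` has no zeros, and it keeps the kernel equation, which is
  -- homogeneous in `u`.
  let c : ℂ → S := fun t => ⟨((‖u t‖⁻¹ : ℝ) : ℂ) • u t, by
    have := norm_ne_zero_iff.2 (hu0 t)
    simp [S, norm_smul, this]⟩
  have hcc : Continuous c := by
    refine Continuous.subtype_mk (Continuous.smul (Complex.continuous_ofReal.comp
      (huc.norm.inv₀ fun t => norm_ne_zero_iff.2 (hu0 t))) huc) _
  obtain ⟨t, ht⟩ := Complex.exists_fixed_point_of_bounded (hκc.comp hcc)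
    (fun t => hM (c t) (Set.mem_univ _))
  have ht' : κ (c t) = t := ht
  have h1 := hκpos (c t)
  rw [ht'] at h1
  refine h1.not_ge (hP _ _ ?_)
  have h2 : t • Y (c t) + G (c t) = ((‖u t‖⁻¹ : ℝ) : ℂ) • (t • Y (u t) + G (u t)) := by
    simp only [c, map_smul, smul_add]
    rw [smul_comm]
  rw [h2, map_smul, huP, smul_zero]

end ShiftedForm

/-! ### Matrices as maps between Euclidean spaces, and column spaces. -/

section Columns

variable {n k m : ℕ}

/-- The linear map `c ↦ M c` between Euclidean spaces. -/
noncomputable def matMap (M : Matrix (Fin n) (Fin k) ℂ) :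
    EuclideanSpace ℂ (Fin k) →L[ℂ] EuclideanSpace ℂ (Fin n) :=
  LinearMap.toContinuousLinearMap (Matrix.toEuclideanLin M)

theorem matMap_apply (M : Matrix (Fin n) (Fin k) ℂ) (c : EuclideanSpace ℂ (Fin k)) :
    matMap M c = WithLp.toLp 2 (M *ᵥ c.ofLp) := rfl

theorem matMap_eq_sum (M : Matrix (Fin n) (Fin k) ℂ) (c : EuclideanSpace ℂ (Fin k)) :
    matMap M c = ∑ a, c a • colVec M a := by
  ext r
  simp [matMap_apply, colVec, Matrix.mulVec, dotProduct, mul_comm]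

theorem matMap_mul (M : Matrix (Fin n) (Fin m) ℂ) (N : Matrix (Fin m) (Fin k) ℂ)
    (c : EuclideanSpace ℂ (Fin k)) : matMap (M * N) c = matMap M (matMap N c) := by
  simp [matMap_apply, Matrix.mulVec_mulVec]

theorem matMap_add (M N : Matrix (Fin n) (Fin k) ℂ) (c : EuclideanSpace ℂ (Fin k)) :
    matMap (M + N) c = matMap M c + matMap N c := by
  simp [matMap_apply, Matrix.add_mulVec]

theorem matMap_sub (M N : Matrix (Fin n) (Fin k) ℂ) (c : EuclideanSpace ℂ (Fin k)) :
    matMap (M - N) c = matMap M c - matMap N c := by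
  simp [matMap_apply, Matrix.sub_mulVec]

theorem matMap_one (c : EuclideanSpace ℂ (Fin k)) : matMap 1 c = c := by
  simp [matMap_apply]

theorem matMap_eq_matOp (H : Matrix (Fin n) (Fin n) ℂ) : matMap H = matOp H := rfl

theorem inner_matMap (M : Matrix (Fin n) (Fin k) ℂ) (c : EuclideanSpace ℂ (Fin k))
    (v : EuclideanSpace ℂ (Fin n)) :
    inner ℂ (matMap M c) v = inner ℂ c (matMap Mᴴ v) := by
  simp only [matMap_apply, EuclideanSpace.inner_eq_star_dotProduct]
  rw [Matrix.star_mulVec, dotProduct_comm, ← Matrix.dotProduct_mulVec, dotProduct_comm]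

theorem range_matMap (M : Matrix (Fin n) (Fin k) ℂ) :
    LinearMap.range (matMap M : EuclideanSpace ℂ (Fin k) →ₗ[ℂ] EuclideanSpace ℂ (Fin n)) =
      colSpan M := by
  apply le_antisymm
  · rintro _ ⟨c, rfl⟩
    change matMap M c ∈ colSpan M
    rw [matMap_eq_sum]
    exact Submodule.sum_mem _ fun a _ =>
      Submodule.smul_mem _ _ (Submodule.subset_span ⟨a, rfl⟩)
  · refine Submodule.span_le.2 ?_
    rintro _ ⟨a, rfl⟩
    refine ⟨EuclideanSpace.single a 1, ?_⟩
    change matMap M _ = _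
    rw [matMap_eq_sum, Finset.sum_eq_single a] <;> simp +contextual

theorem mem_colSpan {M : Matrix (Fin n) (Fin k) ℂ} {v : EuclideanSpace ℂ (Fin n)} :
    v ∈ colSpan M ↔ ∃ c, matMap M c = v := by
  rw [← range_matMap]; rfl

theorem matMap_mem_colSpan (M : Matrix (Fin n) (Fin k) ℂ) (c : EuclideanSpace ℂ (Fin k)) :
    matMap M c ∈ colSpan M := mem_colSpan.2 ⟨c, rfl⟩

theorem finrank_colSpan_of_injective {M : Matrix (Fin n) (Fin k) ℂ}
    (h : ∀ c, matMap M c = 0 → c = 0) : Module.finrank ℂ (colSpan M) = k := by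
  rw [← range_matMap, LinearMap.finrank_range_of_inj, finrank_euclideanSpace_fin]
  exact (injective_iff_map_eq_zero (matMap M)).2 h

theorem finrank_colSpan_of_orthonormal {M : Matrix (Fin n) (Fin k) ℂ}
    (h : Orthonormal ℂ (colVec M)) : Module.finrank ℂ (colSpan M) = k := by
  rw [colSpan, finrank_span_eq_card h.linearIndependent, Fintype.card_fin]

theorem rank_eq_finrank_colSpan (M : Matrix (Fin n) (Fin k) ℂ) :
    M.rank = Module.finrank ℂ (colSpan M) := by
  rw [← range_matMap, Matrix.rank_eq_finrank_range_toLin M (EuclideanSpace.basisFun _ ℂ).toBasis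
    (EuclideanSpace.basisFun _ ℂ).toBasis]
  rfl

end Columns

/-- A subspace contains a nonzero vector in the kernel of fewer functionals than its dimension. -/
theorem Submodule.exists_ne_zero_apply_eq_zero {E : Type*} [AddCommGroup E] [Module ℂ E]
    [FiniteDimensional ℂ E] (V : Submodule ℂ E) {p : ℕ} (hp : p < Module.finrank ℂ V)
    (P : E →ₗ[ℂ] (Fin p → ℂ)) : ∃ v ∈ V, v ≠ 0 ∧ P v = 0 := by
  have h := LinearMap.ker_ne_bot_of_finrank_lt (f := P ∘ₗ V.subtype) (by simpa using hp)
  obtain ⟨v, hv, hv0⟩ := Submodule.exists_mem_ne_zero_of_ne_bot h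
  exact ⟨v, v.2, by simpa using hv0, hv⟩

/-! ### Ritz values and the Courant–Fischer bounds. -/

section Ritz

variable {n : ℕ} {H : Matrix (Fin n) (Fin n) ℂ} (hH : H.IsHermitian)
  (S : Submodule ℂ (EuclideanSpace ℂ (Fin n)))

theorem inner_compression (x y : S) :
    inner ℂ x (compression H S y) = inner ℂ (x : EuclideanSpace ℂ (Fin n)) (matOp H y) := by
  simp [compression]

theorem shiftedForm_eq_sum_ritz (t : ℝ) (x : S) :
    shiftedForm (matOp H) t (x : EuclideanSpace ℂ (Fin n)) =
      ∑ a, ((compression_isSymmetric hH S).eigenvalues rfl a - t) *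
        ‖inner ℂ ((compression_isSymmetric hH S).eigenvectorBasis rfl a) x‖ ^ 2 := by
  set w := (compression_isSymmetric hH S).eigenvectorBasis rfl
  have h1 : inner ℂ (x : EuclideanSpace ℂ (Fin n)) (matOp H x) =
      ∑ a, (((compression_isSymmetric hH S).eigenvalues rfl a * ‖inner ℂ (w a) x‖ ^ 2 : ℝ) : ℂ) := by
    rw [← inner_compression, ← w.sum_inner_mul_inner]
    refine Finset.sum_congr rfl fun a _ => ?_
    have h2 : inner ℂ (w a) (compression H S x) =
        ((compression_isSymmetric hH S).eigenvalues rfl a : ℂ) * inner ℂ (w a) x := by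
      have := (compression_isSymmetric hH S).eigenvectorBasis_apply_self_apply rfl x a
      rwa [OrthonormalBasis.repr_apply_apply, OrthonormalBasis.repr_apply_apply] at this
    rw [h2, ← inner_conj_symm, mul_left_comm, ← Complex.normSq_eq_conj_mul_self,
      Complex.normSq_eq_norm_sq]
    push_cast; rfl
  have h3 : ‖(x : EuclideanSpace ℂ (Fin n))‖ ^ 2 = ∑ a, ‖inner ℂ (w a) x‖ ^ 2 := by
    rw [w.sum_sq_norm_inner_right]; rfl
  rw [shiftedForm, h1, h3, ← Complex.ofReal_sum, Complex.ofReal_re, Finset.mul_sum,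
    ← Finset.sum_sub_distrib]
  simp only [sub_mul]

theorem ritzValue_eq {i : ℕ} (hi : 1 ≤ i) (hiS : i ≤ Module.finrank ℂ S) :
    ritzValue hH S i = (compression_isSymmetric hH S).eigenvalues rfl ⟨i - 1, by omega⟩ :=
  dif_pos ⟨hi, hiS⟩

theorem ritzValue_anti {i k : ℕ} (hi : 1 ≤ i) (hik : i ≤ k) (hk : k ≤ Module.finrank ℂ S) :
    ritzValue hH S k ≤ ritzValue hH S i := by
  rw [ritzValue_eq hH S hi (hik.trans hk), ritzValue_eq hH S (hi.trans hik) hk]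
  exact (compression_isSymmetric hH S).eigenvalues_antitone rfl
    (Fin.mk_le_mk.2 (Nat.sub_le_sub_right hik 1))

/-- The coordinates with respect to the Ritz vectors of the `i - 1` largest Ritz values: on their
common kernel the Rayleigh quotient is at most the `i`-th Ritz value, and the kernel is stable
under the compression. -/
theorem exists_ritz_functionals {i : ℕ} (hi : 1 ≤ i) (hiS : i ≤ Module.finrank ℂ S) :
    ∃ P : EuclideanSpace ℂ (Fin n) →ₗ[ℂ] (Fin (i - 1) → ℂ),
      (∀ v ∈ S, P v = 0 → shiftedForm (matOp H) (ritzValue hH S i) v ≤ 0) ∧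
      (∀ v ∈ S, P v = 0 → P (matOp H v) = 0) := by
  set w := (compression_isSymmetric hH S).eigenvectorBasis rfl with hw
  have hlt : ∀ a : Fin (i - 1), (a : ℕ) < Module.finrank ℂ S := fun a => by omega
  refine ⟨LinearMap.pi fun a => (innerₛₗ ℂ (w ⟨a, hlt a⟩ : EuclideanSpace ℂ (Fin n))), ?_, ?_⟩
  · intro v hv hPv
    have h := shiftedForm_eq_sum_ritz hH S (ritzValue hH S i) ⟨v, hv⟩
    simp only at h
    rw [h]
    refine Finset.sum_nonpos fun a _ => ?_
    rcases lt_or_ge (a : ℕ) (i - 1) with ha | ha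
    · have h1 : inner ℂ (w a : EuclideanSpace ℂ (Fin n)) v = 0 := congrFun hPv ⟨a, ha⟩
      rw [← hw, Submodule.coe_inner, h1]
      simp
    · refine mul_nonpos_of_nonpos_of_nonneg (sub_nonpos.2 ?_) (sq_nonneg _)
      rw [ritzValue_eq hH S hi hiS]
      exact (compression_isSymmetric hH S).eigenvalues_antitone rfl (Fin.mk_le_mk.2 ha)
  · intro v hv hPv
    funext a
    have h1 : inner ℂ (w ⟨a, hlt a⟩ : EuclideanSpace ℂ (Fin n)) v = 0 := congrFun hPv a
    change inner ℂ (w ⟨a, hlt a⟩ : EuclideanSpace ℂ (Fin n)) (matOp H v) = 0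
    rw [← inner_compression S (w ⟨a, hlt a⟩) ⟨v, hv⟩,
      ← (compression_isSymmetric hH S) (w ⟨a, hlt a⟩) ⟨v, hv⟩,
      (compression_isSymmetric hH S).apply_eigenvectorBasis, inner_smul_left]
    exact mul_eq_zero_of_right _ h1

theorem ritzValue_one_le {θ : ℝ} (hS : 1 ≤ Module.finrank ℂ S)
    (h : ∀ v ∈ S, shiftedForm (matOp H) θ v ≤ 0) : ritzValue hH S 1 ≤ θ := by
  set w := (compression_isSymmetric hH S).eigenvectorBasis rfl with hw
  rw [ritzValue_eq hH S le_rfl hS]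
  have h1 := h _ (w ⟨0, hS⟩).2
  rw [shiftedForm_eq_sum_ritz hH S, ← hw, Finset.sum_eq_single ⟨0, hS⟩] at h1
  · rw [w.inner_eq_ite, if_pos rfl] at h1
    simpa using h1
  · intro b _ hb
    rw [w.inner_eq_ite, if_neg hb]; simp
  · simp

theorem ritzValue_span_pair_le {θ : ℝ} {x g : EuclideanSpace ℂ (Fin n)} (hx : x ≠ 0)
    (h : ∀ a b : ℂ, shiftedForm (matOp H) θ (a • x + b • g) ≤ 0) :
    ritzValue hH (Submodule.span ℂ {x, g}) 1 ≤ θ := by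
  refine ritzValue_one_le hH _ ?_ fun v hv => ?_
  · refine Submodule.one_le_finrank_iff.2 fun h0 => hx ?_
    exact (Submodule.mem_bot ℂ).1 (h0 ▸ Submodule.subset_span (by simp))
  · obtain ⟨a, b, rfl⟩ := Submodule.mem_span_pair.1 hv
    exact h a b

/-- The max-min half of Courant–Fischer: `V` is too large to avoid the kernel of the first `i - 1`
Ritz coordinates, where the Rayleigh quotient is at most the `i`-th Ritz value. -/
theorem lt_ritzValue {V : Submodule ℂ (EuclideanSpace ℂ (Fin n))} {i : ℕ} {ν : ℝ} (hVS : V ≤ S)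
    (hi : 1 ≤ i) (hiV : i ≤ Module.finrank ℂ V)
    (h : ∀ v ∈ V, v ≠ 0 → 0 < shiftedForm (matOp H) ν v) : ν < ritzValue hH S i := by
  obtain ⟨P, hP, -⟩ := exists_ritz_functionals hH S hi (hiV.trans (Submodule.finrank_mono hVS))
  obtain ⟨v, hv, hv0, hPv⟩ := V.exists_ne_zero_apply_eq_zero (p := i - 1) (by omega) P
  by_contra! hle
  exact (h v hv hv0).not_ge
    ((shiftedForm_anti (matOp H) v hle).trans (hP v (hVS hv) hPv))

variable {hH S}

theorem IsRayleighRitz.finrank_colSpan {k : ℕ} {Y : Matrix (Fin n) (Fin k) ℂ}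
    (h : IsRayleighRitz hH S Y) : Module.finrank ℂ (colSpan Y) = k :=
  finrank_colSpan_of_orthonormal h.orthonormal

theorem IsRayleighRitz.colSpan_le {k : ℕ} {Y : Matrix (Fin n) (Fin k) ℂ}
    (h : IsRayleighRitz hH S Y) : colSpan Y ≤ S := by
  refine Submodule.span_le.2 ?_
  rintro _ ⟨a, rfl⟩
  exact h.mem a

theorem IsRayleighRitz.compression_matMap {k : ℕ} {Y : Matrix (Fin n) (Fin k) ℂ}
    (h : IsRayleighRitz hH S Y) (c : EuclideanSpace ℂ (Fin k)) :
    (compression H S ⟨matMap Y c, h.colSpan_le (matMap_mem_colSpan Y c)⟩ :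
      EuclideanSpace ℂ (Fin n)) =
    ∑ a, (c a * (ritzValue hH S (a + 1) : ℂ)) • colVec Y a := by
  have h1 : (⟨matMap Y c, h.colSpan_le (matMap_mem_colSpan Y c)⟩ : S) =
      ∑ a, c a • ⟨colVec Y a, h.mem a⟩ := by
    apply Subtype.ext
    simp [matMap_eq_sum]
  rw [h1, map_sum]
  simp only [map_smul, h.ritz, smul_smul]
  simp

theorem IsRayleighRitz.shiftedForm_pos {k : ℕ} {Y : Matrix (Fin n) (Fin k) ℂ}
    (h : IsRayleighRitz hH S Y) {ν : ℝ} (hν : ν < ritzValue hH S k)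
    {v : EuclideanSpace ℂ (Fin n)} (hv : v ∈ colSpan Y) (hv0 : v ≠ 0) :
    0 < shiftedForm (matOp H) ν v := by
  obtain ⟨c, rfl⟩ := mem_colSpan.1 hv
  have hk : k ≤ Module.finrank ℂ S :=
    h.finrank_colSpan.symm.le.trans (Submodule.finrank_mono h.colSpan_le)
  have h1 : inner ℂ (matMap Y c) (matOp H (matMap Y c)) =
      ((∑ a : Fin k, ritzValue hH S (a + 1) * ‖c a‖ ^ 2 : ℝ) : ℂ) := by
    rw [← inner_compression S ⟨matMap Y c, h.colSpan_le hv⟩ ⟨matMap Y c, h.colSpan_le hv⟩,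
      Submodule.coe_inner, h.compression_matMap]
    change inner ℂ (matMap Y c) _ = _
    rw [matMap_eq_sum, h.orthonormal.inner_sum]
    push_cast
    refine Finset.sum_congr rfl fun a _ => ?_
    rw [← mul_assoc, ← Complex.normSq_eq_conj_mul_self, Complex.normSq_eq_norm_sq]
    push_cast; ring
  have h2 : ‖matMap Y c‖ ^ 2 = ∑ a : Fin k, ‖c a‖ ^ 2 := by
    have : inner ℂ (matMap Y c) (matMap Y c) = ((∑ a : Fin k, ‖c a‖ ^ 2 : ℝ) : ℂ) := by
      rw [matMap_eq_sum, h.orthonormal.inner_sum]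
      push_cast
      refine Finset.sum_congr rfl fun a _ => ?_
      rw [← Complex.normSq_eq_conj_mul_self, Complex.normSq_eq_norm_sq]
      push_cast; rfl
    rw [← inner_self_eq_norm_sq (𝕜 := ℂ), this]
    exact Complex.ofReal_re _
  -- The Ritz values are numbered from `1`, so the `k`-th is the smallest one attached to the
  -- columns of `Y`.
  have h3 : ritzValue hH S k * ∑ a : Fin k, ‖c a‖ ^ 2 ≤ ∑ a : Fin k, ritzValue hH S (a + 1) * ‖c a‖ ^ 2 := by
    rw [Finset.mul_sum]
    refine Finset.sum_le_sum fun a _ => mul_le_mul_of_nonneg_right ?_ (sq_nonneg _)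
    exact ritzValue_anti hH S (by omega) (by omega) hk
  have h4 : 0 < ‖matMap Y c‖ ^ 2 := by positivity
  rw [shiftedForm, h1, Complex.ofReal_re, h2]
  rw [h2] at h4
  nlinarith [mul_pos (sub_pos.2 hν) h4]

end Ritz

/-! ### The trial matrix `U` and its rank. -/

section Trial

variable {n k : ℕ}

theorem norm_matMap_le (M : Matrix (Fin n) (Fin k) ℂ) (c : EuclideanSpace ℂ (Fin k)) :
    ‖matMap M c‖ ≤ ‖M‖ * ‖c‖ := Matrix.l2_opNorm_mulVec M c

theorem Matrix.PosDef.eq_zero_of_matOp_eq_zero {H : Matrix (Fin n) (Fin n) ℂ} (hH : H.PosDef)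
    {v : EuclideanSpace ℂ (Fin n)} (hv : matOp H v = 0) : v = 0 := by
  have h1 : H⁻¹ * H = 1 := Matrix.nonsing_inv_mul H ((Matrix.isUnit_iff_isUnit_det H).1 hH.isUnit)
  rw [← matMap_one v, ← h1, matMap_mul, matMap_eq_matOp H, hv, map_zero]

theorem norm_sub_compression_le {H : Matrix (Fin n) (Fin n) ℂ}
    (S : Submodule ℂ (EuclideanSpace ℂ (Fin n))) (x : S) :
    ‖matOp H x - (compression H S x : EuclideanSpace ℂ (Fin n))‖ ≤
      ‖matOp H (x : EuclideanSpace ℂ (Fin n))‖ := by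
  set p := compression H S x with hp
  have h1 : inner ℂ (p : EuclideanSpace ℂ (Fin n)) (matOp H x - p) = 0 := by
    rw [inner_sub_right, ← inner_compression S p x, ← Submodule.coe_inner, ← hp, sub_self]
  have h2 := norm_add_sq_eq_norm_sq_add_norm_sq_of_inner_eq_zero _ _ h1
  rw [add_sub_cancel] at h2
  nlinarith [norm_nonneg (matOp H (x : EuclideanSpace ℂ (Fin n))), mul_self_nonneg ‖(p : EuclideanSpace ℂ (Fin n))‖,
    norm_nonneg (matOp H (x : EuclideanSpace ℂ (Fin n)) - p)]

/-- Since `Y Θ c` is the compression of `H` applied to `Y c`, the trial matrix is `H Y` perturbed by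
`1 - N` acting on the residual. -/
theorem IsRayleighRitz.matMap_trialMatrix {H : Matrix (Fin n) (Fin n) ℂ} {hH : H.IsHermitian}
    {Y : Matrix (Fin n) (Fin k) ℂ} (h : IsRayleighRitz hH (colSpan Y) Y)
    (N : Matrix (Fin n) (Fin n) ℂ) (c : EuclideanSpace ℂ (Fin k)) :
    matMap (trialMatrix hH N Y) c = matOp H (matMap Y c) - matMap (1 - N) (matOp H (matMap Y c) -
      (compression H (colSpan Y) ⟨matMap Y c, matMap_mem_colSpan Y c⟩ :
        EuclideanSpace ℂ (Fin n))) := by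
  have h1 : matMap (Y * ritzDiag hH Y) c =
      compression H (colSpan Y) ⟨matMap Y c, matMap_mem_colSpan Y c⟩ := by
    rw [h.compression_matMap, matMap_mul, matMap_eq_sum]
    refine Finset.sum_congr rfl fun a _ => ?_
    congr 1
    simp [matMap_apply, ritzDiag, Matrix.mulVec_diagonal, mul_comm]
  rw [trialMatrix, matMap_add, matMap_mul N, matMap_sub, h1, matMap_mul H, matMap_sub,
    matMap_one, matMap_eq_matOp H]
  abel

/-- The residual is an orthogonal component of `H Y c`, hence no longer than it. If `U c = 0`, then
`‖H Y c‖ ≤ ‖1 - N‖ ‖H Y c‖`, which forces `H Y c = 0`. -/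
theorem IsRayleighRitz.trialMatrix_injective {H N : Matrix (Fin n) (Fin n) ℂ} (hH : H.PosDef)
    {Y : Matrix (Fin n) (Fin k) ℂ} (h : IsRayleighRitz hH.isHermitian (colSpan Y) Y)
    (hN : ‖1 - N‖ < 1) {c : EuclideanSpace ℂ (Fin k)}
    (hc : matMap (trialMatrix hH.isHermitian N Y) c = 0) : c = 0 := by
  rw [h.matMap_trialMatrix, sub_eq_zero] at hc
  set y : colSpan Y := ⟨matMap Y c, matMap_mem_colSpan Y c⟩ with hy
  have h1 : ‖matOp H (y : EuclideanSpace ℂ (Fin n))‖ ≤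
      ‖1 - N‖ * ‖matOp H (y : EuclideanSpace ℂ (Fin n))‖ := by
    calc ‖matOp H (y : EuclideanSpace ℂ (Fin n))‖
        = ‖matMap (1 - N) (matOp H (matMap Y c) - (compression H (colSpan Y) y :
          EuclideanSpace ℂ (Fin n)))‖ := by rw [← hc]
      _ ≤ ‖1 - N‖ * ‖matOp H (matMap Y c) - (compression H (colSpan Y) y :
          EuclideanSpace ℂ (Fin n))‖ := norm_matMap_le _ _
      _ ≤ _ := mul_le_mul_of_nonneg_left (norm_sub_compression_le _ y) (norm_nonneg _)
  have h2 : ‖matOp H (y : EuclideanSpace ℂ (Fin n))‖ = 0 := by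
    nlinarith [norm_nonneg (matOp H (y : EuclideanSpace ℂ (Fin n)))]
  have h3 : matMap Y c = 0 := hH.eq_zero_of_matOp_eq_zero (norm_eq_zero.1 h2)
  rw [matMap_eq_sum] at h3
  ext a
  exact Fintype.linearIndependent_iff.1 h.orthonormal.linearIndependent _ h3 a

theorem colSpan_trialMatrix_one {H : Matrix (Fin n) (Fin n) ℂ} (hH : H.IsHermitian)
    (Y : Matrix (Fin n) (Fin k) ℂ) : colSpan (trialMatrix hH 1 Y) = (colSpan Y).map
      (matOp H : EuclideanSpace ℂ (Fin n) →ₗ[ℂ] EuclideanSpace ℂ (Fin n)) := by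
  have h : trialMatrix hH 1 Y = H * Y := by simp [trialMatrix]
  ext v
  rw [h, mem_colSpan, Submodule.mem_map]
  constructor
  · rintro ⟨c, rfl⟩
    exact ⟨_, matMap_mem_colSpan Y c, (matMap_mul H Y c).symm⟩
  · rintro ⟨y, hy, rfl⟩
    obtain ⟨c, rfl⟩ := mem_colSpan.1 hy
    exact ⟨c, matMap_mul H Y c⟩

end Trial

/-! ### Orthogonal complements of groups of eigenvectors. -/

section OrthSpan

variable {n : ℕ}

theorem mem_orthSpan {z : Fin n → EuclideanSpace ℂ (Fin n)} {p q : ℕ}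
    {v : EuclideanSpace ℂ (Fin n)} : v ∈ orthSpan z p q ↔
      ∀ a : Fin n, p ≤ (a : ℕ) → (a : ℕ) < q → inner ℂ (z a) v = 0 := by
  constructor
  · intro h a ha hb
    exact (Submodule.mem_orthogonal _ v).1 h _ (Submodule.subset_span ⟨a, ha, hb, rfl⟩)
  · intro h
    rw [orthSpan, ← Submodule.span_singleton_le_iff_mem, Submodule.le_orthogonal_iff_le_orthogonal,
      Submodule.span_le]
    rintro _ ⟨a, ha, hb, rfl⟩
    rw [SetLike.mem_coe, Submodule.mem_orthogonal_singleton_iff_inner_left]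
    exact h a ha hb

theorem orthSpan_inf_orthSpan (z : Fin n → EuclideanSpace ℂ (Fin n)) {p q r : ℕ} :
    orthSpan z q r ⊓ orthSpan z p q ≤ orthSpan z p r := by
  rintro v ⟨h1, h2⟩
  rw [SetLike.mem_coe, mem_orthSpan] at h1 h2
  refine mem_orthSpan.2 fun a ha hb => ?_
  rcases lt_or_ge (a : ℕ) q with h | h
  · exact h2 a ha h
  · exact h1 a h hb

theorem finrank_le_finrank_inf_orthSpan_add (z : Fin n → EuclideanSpace ℂ (Fin n)) (p q : ℕ)
    (V : Submodule ℂ (EuclideanSpace ℂ (Fin n))) : Module.finrank ℂ V ≤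
      Module.finrank ℂ (V ⊓ orthSpan z p q : Submodule ℂ (EuclideanSpace ℂ (Fin n))) + (q - p) := by
  set K := Submodule.span ℂ {v | ∃ a : Fin n, p ≤ (a : ℕ) ∧ (a : ℕ) < q ∧ v = z a} with hK
  have h1 : Module.finrank ℂ K ≤ q - p := by
    let f : Fin (q - p) → EuclideanSpace ℂ (Fin n) :=
      fun a => if h : p + a < n then z ⟨p + a, h⟩ else 0
    have h2 : K ≤ Submodule.span ℂ (Set.range f) := by
      refine Submodule.span_mono ?_
      rintro _ ⟨a, ha, hb, rfl⟩
      refine ⟨⟨a - p, by omega⟩, ?_⟩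
      have h3 : p + (a - p : ℕ) = a := by omega
      simp [f, h3]
    exact (Submodule.finrank_mono h2).trans ((finrank_range_le_card f).trans_eq (Fintype.card_fin _))
  have h4 := K.finrank_add_finrank_orthogonal
  have h5 := Submodule.finrank_sup_add_finrank_inf_eq V Kᗮ
  have h6 := Submodule.finrank_le (V ⊔ Kᗮ)
  change _ ≤ Module.finrank ℂ (V ⊓ Kᗮ : Submodule ℂ (EuclideanSpace ℂ (Fin n))) + _
  omega

variable {H : Matrix (Fin n) (Fin n) ℂ} {z : OrthonormalBasis (Fin n) ℂ (EuclideanSpace ℂ (Fin n))}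
  {μ : Fin n → ℝ}

theorem inner_eigenvector_matOp (hH : H.IsHermitian)
    (hz : ∀ a, matOp H (z a) = (μ a : ℂ) • z a) (a : Fin n) (v : EuclideanSpace ℂ (Fin n)) :
    inner ℂ (z a) (matOp H v) = (μ a : ℂ) * inner ℂ (z a) v := by
  have h : inner ℂ (matOp H (z a)) v = inner ℂ (z a) (matOp H v) := matOp_isSymmetric hH (z a) v
  rw [← h, hz, inner_smul_left, Complex.conj_ofReal]

/-- `H` multiplies each eigenvector coordinate by a nonzero eigenvalue. -/
theorem matOp_mem_orthSpan_iff (hH : H.PosDef)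
    (hz : ∀ a, matOp H (z a) = (μ a : ℂ) • z a) {p q : ℕ} {v : EuclideanSpace ℂ (Fin n)} :
    matOp H v ∈ orthSpan z p q ↔ v ∈ orthSpan z p q := by
  have h0 : ∀ a, (μ a : ℂ) ≠ 0 := fun a h => z.orthonormal.ne_zero a
    (hH.eq_zero_of_matOp_eq_zero (by rw [hz, h, zero_smul]))
  simp only [mem_orthSpan, inner_eigenvector_matOp hH.isHermitian hz, mul_eq_zero, h0, false_or]

theorem shiftedForm_nonpos_of_mem_orthSpan (hH : H.IsHermitian) (hμ : Antitone μ)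
    (hz : ∀ a, matOp H (z a) = (μ a : ℂ) • z a) {s : ℕ} (hs : s < n)
    {v : EuclideanSpace ℂ (Fin n)} (hv : v ∈ orthSpan z 0 s) :
    shiftedForm (matOp H) (μ ⟨s, hs⟩) v ≤ 0 := by
  have h1 : inner ℂ v (matOp H v) = ((∑ a, μ a * ‖inner ℂ (z a) v‖ ^ 2 : ℝ) : ℂ) := by
    rw [← z.sum_inner_mul_inner, Complex.ofReal_sum]
    refine Finset.sum_congr rfl fun a _ => ?_
    rw [inner_eigenvector_matOp hH hz, ← inner_conj_symm, mul_left_comm,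
      ← Complex.normSq_eq_conj_mul_self, Complex.normSq_eq_norm_sq]
    push_cast; rfl
  rw [shiftedForm, h1, Complex.ofReal_re, ← z.sum_sq_norm_inner_right v, Finset.mul_sum,
    ← Finset.sum_sub_distrib]
  refine Finset.sum_nonpos fun a _ => ?_
  rcases lt_or_ge (a : ℕ) s with h | h
  · rw [mem_orthSpan.1 hv a (Nat.zero_le _) h]; simp
  · have := mul_le_mul_of_nonneg_right (hμ (Fin.mk_le_of_le_val (b := a) h))
      (sq_nonneg ‖inner ℂ (z a) v‖)
    linarith

end OrthSpan

/-! ### Planes whose largest Ritz value lies below the `i`-th Ritz value. -/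

section Planes

variable {n i : ℕ}

theorem norm_matMap_of_conjTranspose_mul_self {Y : Matrix (Fin n) (Fin i) ℂ} (hY : Yᴴ * Y = 1)
    (c : EuclideanSpace ℂ (Fin i)) : ‖matMap Y c‖ = ‖c‖ := by
  have h : inner ℂ (matMap Y c) (matMap Y c) = inner ℂ c c := by
    rw [inner_matMap, ← matMap_mul, hY, matMap_one]
  rw [inner_self_eq_norm_sq_to_K, inner_self_eq_norm_sq_to_K] at h
  have h' : ‖matMap Y c‖ ^ 2 = ‖c‖ ^ 2 := by exact_mod_cast h
  exact (sq_eq_sq₀ (norm_nonneg _) (norm_nonneg _)).1 h'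

theorem matMap_eq_zero_of_rank {R : Matrix (Fin n) (Fin i) ℂ} (hR : R.rank = i)
    {c : EuclideanSpace ℂ (Fin i)} (hc : matMap R c = 0) : c = 0 := by
  rw [rank_eq_finrank_colSpan, ← range_matMap] at hR
  have h := LinearMap.finrank_range_add_finrank_ker
    (matMap R : EuclideanSpace ℂ (Fin i) →ₗ[ℂ] EuclideanSpace ℂ (Fin n))
  rw [hR, finrank_euclideanSpace_fin, Nat.add_eq_left, Submodule.finrank_eq_zero] at h
  exact (Submodule.mem_bot ℂ).1 (h ▸ LinearMap.mem_ker.2 hc)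

open scoped MatrixOrder in
/-- Multiplication by `(R^* R)^{-1/2}` compares a matrix with `R`. -/
theorem norm_matMap_le_of_norm_mul_invSqrt {S R : Matrix (Fin n) (Fin i) ℂ} (hR : R.rank = i)
    {t : ℝ} (h : ‖S * invSqrt (Rᴴ * R)‖ ≤ t) (c : EuclideanSpace ℂ (Fin i)) :
    ‖matMap S c‖ ≤ t * ‖matMap R c‖ := by
  set M := Rᴴ * R with hMdef
  have hM : M.PosDef := by
    refine Matrix.PosDef.conjTranspose_mul_self R fun x y hxy => ?_
    have h1 : matMap R (WithLp.toLp 2 (x - y)) = 0 := by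
      simp [matMap_apply, Matrix.mulVec_sub, hxy]
    have h2 := matMap_eq_zero_of_rank hR h1
    exact sub_eq_zero.1 (congrArg WithLp.ofLp h2)
  set Q := invSqrt M with hQ
  have hQQ : Q * Q = M⁻¹ := CFC.sqrt_mul_sqrt_self _ hM.inv.posSemidef.nonneg
  have hQh : Qᴴ = Q := (Matrix.nonneg_iff_posSemidef.1 (CFC.sqrt_nonneg M⁻¹)).isHermitian
  have hMM : M⁻¹ * M = 1 :=
    Matrix.nonsing_inv_mul M ((Matrix.isUnit_iff_isUnit_det M).1 hM.isUnit)
  -- This is `(R^* R)^{1/2} c`: it has the norm of `R c`, and `Q` sends it back to `c`.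
  set d := matMap (Q * M) c with hd
  have hQd : matMap Q d = c := by
    rw [hd, ← matMap_mul, ← mul_assoc, hQQ, hMM, matMap_one]
  have hdn : ‖d‖ = ‖matMap R c‖ := by
    have h1 : inner ℂ d d = inner ℂ (matMap R c) (matMap R c) := by
      rw [hd, inner_matMap, ← hd, Matrix.conjTranspose_mul, hQh, matMap_mul, hQd, hM.isHermitian,
        inner_matMap, ← matMap_mul]
    rw [inner_self_eq_norm_sq_to_K, inner_self_eq_norm_sq_to_K] at h1
    have h' : ‖d‖ ^ 2 = ‖matMap R c‖ ^ 2 := by exact_mod_cast h1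
    exact (sq_eq_sq₀ (norm_nonneg _) (norm_nonneg _)).1 h'
  calc ‖matMap S c‖ = ‖matMap (S * Q) d‖ := by rw [matMap_mul, hQd]
    _ ≤ ‖S * Q‖ * ‖d‖ := norm_matMap_le _ _
    _ ≤ t * ‖matMap R c‖ := by rw [hdn]; exact mul_le_mul_of_nonneg_right h (norm_nonneg _)

/-- In an `i`-dimensional subspace `V` of `W` whose image under `H` stays in `W`, some plane
`span {y, H y}` has its largest Ritz value below the `i`-th Ritz value in `W`. -/
theorem exists_ritzValue_span_pair_le_of_map_le {H : Matrix (Fin n) (Fin n) ℂ}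
    (hH : H.IsHermitian) {V W : Submodule ℂ (EuclideanSpace ℂ (Fin n))} (hVW : V ≤ W)
    (hHV : ∀ v ∈ V, matOp H v ∈ W) (hi : 1 ≤ i) (hV : Module.finrank ℂ V = i) :
    ∃ y ∈ V, y ≠ 0 ∧
      ritzValue hH (Submodule.span ℂ {y, matOp H y}) 1 ≤ ritzValue hH W i := by
  obtain ⟨P, hP, hPH⟩ := exists_ritz_functionals hH W hi (hV.ge.trans (Submodule.finrank_mono hVW))
  obtain ⟨y, hy, hy0, hPy⟩ := V.exists_ne_zero_apply_eq_zero (p := i - 1) (by omega) P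
  refine ⟨y, hy, hy0, ritzValue_span_pair_le hH hy0 fun a b => hP _ ?_ ?_⟩
  · exact W.add_mem (W.smul_mem _ (hVW hy)) (W.smul_mem _ (hHV y hy))
  · rw [map_add, map_smul, map_smul, hPy, hPH y (hVW hy) hPy]; simp

/-- Let `Y` and `U` have orthonormal columns in `W`. If `U` captures the columns of `H Y` up to a
relative error `t < 1` with respect to the block residual, then for some `y` in the span of `Y`, with
`u` the projection of `H y`, the largest Ritz value in `span {y, u}` is below the `i`-th Ritz
value in `W`. -/
theorem exists_ritzValue_span_pair_le {H : Matrix (Fin n) (Fin n) ℂ} (hH : H.IsHermitian)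
    {W : Submodule ℂ (EuclideanSpace ℂ (Fin n))} (hi : 1 ≤ i) {U Y : Matrix (Fin n) (Fin i) ℂ}
    {t : ℝ} (hUW : colSpan U ≤ W) (hYY : Yᴴ * Y = 1) (hYW : colSpan Y ≤ W)
    (hR : (H * Y - Y * Yᴴ * H * Y).rank = i)
    (hγ : ‖(H * Y - U * Uᴴ * H * Y) *
      invSqrt ((H * Y - Y * Yᴴ * H * Y)ᴴ * (H * Y - Y * Yᴴ * H * Y))‖ ≤ t) (ht : t < 1) :
    ∃ y ∈ colSpan Y, ∃ u ∈ colSpan U, y ≠ 0 ∧ u ≠ 0 ∧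
      ‖matOp H y - u‖ ≤
        t * ‖matOp H y - (((matOp H).rayleighQuotient y : ℝ) : ℂ) • y‖ ∧
      ritzValue hH (Submodule.span ℂ {y, u}) 1 ≤ ritzValue hH W i := by
  have ht0 : 0 ≤ t := (norm_nonneg _).trans hγ
  set R := H * Y - Y * Yᴴ * H * Y with hRdef
  set G := matMap (U * (Uᴴ * H * Y)) with hG
  have hHY : ∀ c, matMap (H * Y) c = matOp H (matMap Y c) := fun c => matMap_mul H Y c
  have herr : ∀ c, ‖matOp H (matMap Y c) - G c‖ ≤ t * ‖matMap R c‖ := fun c => by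
    have h1 := norm_matMap_le_of_norm_mul_invSqrt hR hγ c
    have h0 : U * Uᴴ * H * Y = U * (Uᴴ * H * Y) := by simp only [Matrix.mul_assoc]
    rwa [matMap_sub, hHY, h0, ← hG] at h1
  have hR0 : ∀ c, c ≠ 0 → 0 < ‖matMap R c‖ := fun c hc =>
    norm_pos_iff.2 fun h => hc (matMap_eq_zero_of_rank hR h)
  -- `R c` is the component of `H Y c` orthogonal to the span of `Y`, and subtracting a multiple of
  -- `Y c` does not alter that component.
  have hres : ∀ (c) (m : ℂ), ‖matMap R c‖ ≤ ‖matOp H (matMap Y c) - m • matMap Y c‖ := by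
    intro c m
    have h0 : Y * Yᴴ * H * Y = Y * (Yᴴ * H * Y) := by simp only [Matrix.mul_assoc]
    have h1 : matOp H (matMap Y c) - m • matMap Y c =
        matMap Y (matMap (Yᴴ * H * Y) c - m • c) + matMap R c := by
      rw [hRdef, matMap_sub, hHY, h0, matMap_mul Y, map_sub,
        map_smul]
      abel
    have h2 : inner ℂ (matMap Y (matMap (Yᴴ * H * Y) c - m • c)) (matMap R c) = 0 := by
      have h3 : Yᴴ * R = 0 := by
        simp only [hRdef, Matrix.mul_sub, ← Matrix.mul_assoc, hYY, Matrix.one_mul, sub_self]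
      rw [inner_matMap, ← matMap_mul, h3]
      simp [matMap_apply]
    have h4 := norm_add_sq_eq_norm_sq_add_norm_sq_of_inner_eq_zero _ _ h2
    rw [← h1] at h4
    exact abs_le_of_sq_le_sq' (by nlinarith [mul_self_nonneg ‖matMap Y (matMap (Yᴴ * H * Y) c - m • c)‖])
      (norm_nonneg _) |>.2
  have hY0 : ∀ c, c ≠ 0 → matMap Y c ≠ 0 := fun c hc => by
    rw [← norm_ne_zero_iff, norm_matMap_of_conjTranspose_mul_self hYY]
    exact norm_ne_zero_iff.2 hc
  have hsymm := matOp_isSymmetric hH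
  -- Here `m` is the Rayleigh quotient of `x = Y c`, so `r = H x - m x` is orthogonal to `x`. The
  -- inner product in question is `⟨r, G c⟩`, with real part at least `(1 - t) ‖r‖²`, because `G c`
  -- misses `H x` by at most `t ‖r‖`.
  have hYG : ∀ c, c ≠ 0 → ∀ m : ℝ, shiftedForm (matOp H) m (matMap Y c) = 0 →
      inner ℂ (matMap Y c) (matOp H (G c) - (m : ℂ) • G c) ≠ 0 := by
    intro c hc m hm h0
    set x := matMap Y c with hx
    set r := matOp H x - (m : ℂ) • x with hr
    have hrn : 0 < ‖r‖ := (hR0 c hc).trans_le (hres c m)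
    have h1 : inner ℂ x (matOp H (G c) - (m : ℂ) • G c) = inner ℂ r (G c) := by
      have h2 : inner ℂ (matOp H x) (G c) = inner ℂ x (matOp H (G c)) := hsymm x (G c)
      rw [hr, inner_sub_left, inner_sub_right, inner_smul_left, inner_smul_right,
        Complex.conj_ofReal, h2]
    have h3 : (inner ℂ r x).re = 0 := by
      have h2 : inner ℂ (matOp H x) x = inner ℂ x (matOp H x) := hsymm x x
      have h4 : inner ℂ x x = ((‖x‖ ^ 2 : ℝ) : ℂ) := by
        rw [inner_self_eq_norm_sq_to_K]; push_cast; rfl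
      rw [hr, inner_sub_left, inner_smul_left, Complex.conj_ofReal, h2, Complex.sub_re, h4,
        ← Complex.ofReal_mul, Complex.ofReal_re]
      exact hm
    have h5 : G c = r + (m : ℂ) • x - (matOp H x - G c) := by rw [hr]; abel
    have h6 : (inner ℂ r (G c)).re = ‖r‖ ^ 2 - (inner ℂ r (matOp H x - G c)).re := by
      have h7 : (inner ℂ r r).re = ‖r‖ ^ 2 := inner_self_eq_norm_sq (𝕜 := ℂ) r
      conv_lhs => rw [h5]
      rw [inner_sub_right, inner_add_right, inner_smul_right, Complex.sub_re, Complex.add_re,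
        Complex.re_ofReal_mul, h3, h7]
      ring
    have h8 : (inner ℂ r (matOp H x - G c)).re ≤ ‖r‖ * (t * ‖r‖) :=
      (re_inner_le_norm (𝕜 := ℂ) _ _).trans (mul_le_mul_of_nonneg_left
        ((herr c).trans (mul_le_mul_of_nonneg_left (hres c m) ht0)) (norm_nonneg _))
    rw [h1] at h0
    rw [h0, Complex.zero_re] at h6
    nlinarith [mul_pos (sub_pos.2 ht) (mul_pos hrn hrn)]
  have hGU : ∀ c, G c ∈ colSpan U := fun c => by
    rw [hG, matMap_mul]; exact matMap_mem_colSpan _ _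
  have hYfin : Module.finrank ℂ (colSpan Y) = i :=
    finrank_colSpan_of_injective fun c hc => by
      by_contra h
      exact hY0 c h hc
  obtain ⟨P, hP, -⟩ := exists_ritz_functionals hH W hi
    (hYfin.ge.trans (Submodule.finrank_mono hYW))
  obtain ⟨c, hc, hcθ⟩ := exists_plane_shiftedForm_nonpos (p := i - 1) (k := i) (by omega) hsymm
    (matMap Y) G hY0 hYG P (ritzValue hH W i) fun c a h => hP _
      (W.add_mem (W.smul_mem _ (hYW (matMap_mem_colSpan Y c))) (hUW (hGU c))) h
  refine ⟨_, matMap_mem_colSpan Y c, _, hGU c, hY0 c hc, fun h0 => ?_,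
    (herr c).trans (mul_le_mul_of_nonneg_left (hres c _) ht0),
    ritzValue_span_pair_le hH (hY0 c hc) hcθ⟩
  -- If `G c = 0`, then `‖R c‖ ≤ ‖H Y c‖ ≤ t ‖R c‖`, impossible for `t < 1`.
  have h1 := herr c
  have h2 := hres c 0
  rw [h0, sub_zero] at h1
  rw [zero_smul, sub_zero] at h2
  nlinarith [hR0 c hc]

end Planes

/-! ### Persistence of the dimensions along the iteration. -/

namespace SplitIteration

variable {n : ℕ} {H : Matrix (Fin n) (Fin n) ℂ} {hH : H.IsHermitian}
  {N : Matrix (Fin n) (Fin n) ℂ} {Zt Zh : Submodule ℂ (EuclideanSpace ℂ (Fin n))} {s : ℕ}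

/-- The last Rayleigh–Ritz step keeps as many vectors as its space has dimensions, so it only
changes the basis. -/
theorem colSpan_succ (I : SplitIteration hH N Zt Zh s) (l : ℕ) :
    colSpan (I.Y (l + 1)) = colSpan (I.Yt l) ⊔ colSpan (I.Yh l) :=
  Submodule.eq_of_le_of_finrank_eq (I.next l).colSpan_le
    ((I.next l).finrank_colSpan.trans (I.cols_succ l))

theorem isRayleighRitz (I : SplitIteration hH N Zt Zh s) :
    ∀ l, IsRayleighRitz hH (colSpan (I.Y l)) (I.Y l)
  | 0 => I.init
  | l + 1 => by
    have h := I.next l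
    rwa [← I.colSpan_succ l] at h

theorem colSpan_Yt_le (I : SplitIteration hH N Zt Zh s) (l : ℕ) : colSpan (I.Yt l) ≤ Zt :=
  (I.partial_t l).colSpan_le.trans (sup_le inf_le_right inf_le_right)

theorem colSpan_Yh_le (I : SplitIteration hH N Zt Zh s) (l : ℕ) : colSpan (I.Yh l) ≤ Zh :=
  (I.partial_h l).colSpan_le.trans (sup_le inf_le_right inf_le_right)

/-- A strict lower bound of the Rayleigh quotient on a partial space passes to the Ritz vectors of
the larger trial space. -/
theorem shiftedForm_pos_of_partial {V W : Submodule ℂ (EuclideanSpace ℂ (Fin n))} (hVW : V ≤ W)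
    {Y : Matrix (Fin n) (Fin (Module.finrank ℂ V)) ℂ} (hY : IsRayleighRitz hH W Y) {ν : ℝ}
    (h : ∀ v ∈ V, v ≠ 0 → 0 < shiftedForm (matOp H) ν v) :
    ∀ v ∈ colSpan Y, v ≠ 0 → 0 < shiftedForm (matOp H) ν v := by
  intro v hv hv0
  -- Excludes index `0`, at which `ritzValue` is only a default value.
  have h1 : 1 ≤ Module.finrank ℂ V := by
    rw [← hY.finrank_colSpan]
    exact Submodule.one_le_finrank_iff.2 fun h0 => hv0 ((Submodule.mem_bot ℂ).1 (h0 ▸ hv))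
  exact hY.shiftedForm_pos (lt_ritzValue hH W hVW h1 le_rfl h) hv hv0

/-- If the Rayleigh quotient is at most `ν` on `Zt ⊓ Zh` and larger than `ν` on the partial spaces,
then the next partial spaces are spanned by the partial iterates, on which it is again larger
than `ν`. -/
theorem partial_spaces_succ (I : SplitIteration hH N Zt Zh s) {ν : ℝ}
    (hν : ∀ v ∈ Zt ⊓ Zh, shiftedForm (matOp H) ν v ≤ 0) {l : ℕ}
    (ht : ∀ v ∈ I.spaceYt l, v ≠ 0 → 0 < shiftedForm (matOp H) ν v)
    (hh : ∀ v ∈ I.spaceYh l, v ≠ 0 → 0 < shiftedForm (matOp H) ν v) :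
    (∀ v ∈ I.spaceYt (l + 1), v ≠ 0 → 0 < shiftedForm (matOp H) ν v) ∧
    (∀ v ∈ I.spaceYh (l + 1), v ≠ 0 → 0 < shiftedForm (matOp H) ν v) ∧
    Module.finrank ℂ (I.spaceYt (l + 1)) = Module.finrank ℂ (I.spaceYt l) ∧
    Module.finrank ℂ (I.spaceYh (l + 1)) = Module.finrank ℂ (I.spaceYh l) ∧
    Module.finrank ℂ (colSpan (I.Y (l + 1))) =
      Module.finrank ℂ (I.spaceYt l) + Module.finrank ℂ (I.spaceYh l) := by
  have hT := shiftedForm_pos_of_partial le_sup_left (I.partial_t l) ht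
  have hHat := shiftedForm_pos_of_partial le_sup_left (I.partial_h l) hh
  have hTbot : colSpan (I.Yt l) ⊓ Zh = ⊥ := by
    refine (Submodule.eq_bot_iff _).2 fun v hv => ?_
    by_contra hv0
    exact (hT v hv.1 hv0).not_ge (hν v ⟨I.colSpan_Yt_le l hv.1, hv.2⟩)
  have hHbot : colSpan (I.Yh l) ⊓ Zt = ⊥ := by
    refine (Submodule.eq_bot_iff _).2 fun v hv => ?_
    by_contra hv0
    exact (hHat v hv.1 hv0).not_ge (hν v ⟨hv.2, I.colSpan_Yh_le l hv.1⟩)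
  -- Modular law: the first summand lies in `Zt`, the second meets `Zt` trivially.
  have e1 : I.spaceYt (l + 1) = colSpan (I.Yt l) := by
    rw [spaceYt, I.colSpan_succ, sup_inf_assoc_of_le _ (I.colSpan_Yt_le l), hHbot, sup_bot_eq]
  have e2 : I.spaceYh (l + 1) = colSpan (I.Yh l) := by
    rw [spaceYh, I.colSpan_succ, sup_comm, sup_inf_assoc_of_le _ (I.colSpan_Yh_le l), hTbot,
      sup_bot_eq]
  have f1 : Module.finrank ℂ (colSpan (I.Yt l)) = Module.finrank ℂ (I.spaceYt l) :=
    (I.partial_t l).finrank_colSpan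
  have f2 : Module.finrank ℂ (colSpan (I.Yh l)) = Module.finrank ℂ (I.spaceYh l) :=
    (I.partial_h l).finrank_colSpan
  rw [e1, e2]
  refine ⟨hT, hHat, f1, f2, ?_⟩
  have h1 := Submodule.finrank_sup_add_finrank_inf_eq (colSpan (I.Yt l)) (colSpan (I.Yh l))
  have h2 : colSpan (I.Yt l) ⊓ colSpan (I.Yh l) = ⊥ :=
    le_bot_iff.1 (hTbot ▸ inf_le_inf_left _ (I.colSpan_Yh_le l))
  rw [h2, finrank_bot, add_zero, f1, f2] at h1
  rw [I.colSpan_succ, h1]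

/-- If the Rayleigh quotient is at most `ν` on `Zt ⊓ Zh` and larger than `ν` on the initial space,
and the initial partial spaces have at least the dimensions `i` and `s - i`, then all dimensions
are preserved by the iteration. -/
theorem finrank_eq_of_shiftedForm_pos (I : SplitIteration hH N Zt Zh s) {ν : ℝ} {i : ℕ}
    (his : i ≤ s) (hν : ∀ v ∈ Zt ⊓ Zh, shiftedForm (matOp H) ν v ≤ 0)
    (h0 : ∀ v ∈ colSpan (I.Y 0), v ≠ 0 → 0 < shiftedForm (matOp H) ν v)
    (ht : i ≤ Module.finrank ℂ (I.spaceYt 0)) (hh : s - i ≤ Module.finrank ℂ (I.spaceYh 0))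
    (l : ℕ) : Module.finrank ℂ (colSpan (I.Y l)) = s ∧ Module.finrank ℂ (I.spaceYt l) = i ∧
      Module.finrank ℂ (I.spaceYh l) = s - i := by
  suffices h : (∀ v ∈ I.spaceYt l, v ≠ 0 → 0 < shiftedForm (matOp H) ν v) ∧
      (∀ v ∈ I.spaceYh l, v ≠ 0 → 0 < shiftedForm (matOp H) ν v) ∧
      Module.finrank ℂ (colSpan (I.Y l)) = s ∧ Module.finrank ℂ (I.spaceYt l) = i ∧
      Module.finrank ℂ (I.spaceYh l) = s - i from h.2.2
  induction l with
  | zero =>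
    have hs : Module.finrank ℂ (colSpan (I.Y 0)) = s := I.init.finrank_colSpan.trans I.cols_zero
    refine ⟨fun v hv => h0 v hv.1, fun v hv => h0 v hv.1, hs, ?_⟩
    -- The two parts are independent inside an `s`-dimensional space, so their lower bounds `i` and
    -- `s - i` are equalities.
    have h1 := Submodule.finrank_sup_add_finrank_inf_eq (I.spaceYt 0) (I.spaceYh 0)
    have h2 : I.spaceYt 0 ⊓ I.spaceYh 0 = ⊥ := by
      refine (Submodule.eq_bot_iff _).2 fun v hv => ?_
      by_contra hv0
      exact (h0 v hv.1.1 hv0).not_ge (hν v ⟨hv.1.2, hv.2.2⟩)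
    have h3 : Module.finrank ℂ (I.spaceYt 0 ⊔ I.spaceYh 0 :
        Submodule ℂ (EuclideanSpace ℂ (Fin n))) ≤ s :=
      (Submodule.finrank_mono (sup_le inf_le_left inf_le_left)).trans_eq hs
    rw [h2, finrank_bot] at h1
    omega
  | succ l ih =>
    obtain ⟨h1, h2, h3, h4, h5⟩ := ih
    obtain ⟨g1, g2, g3, g4, g5⟩ := I.partial_spaces_succ hν h1 h2
    exact ⟨g1, g2, by omega, by omega, by omega⟩

end SplitIteration

/-! ### Assembly of the three assertions. -/

theorem theorem3p1 {n : ℕ} (H N : Matrix (Fin n) (Fin n) ℂ) (hH : H.PosDef) (hN : N.PosDef)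
    (γ : ℝ) (hNγ : ‖1 - N‖ ≤ γ) (hγ : γ < 1)
    -- orthonormal eigenvectors of `H` for the decreasingly ordered eigenvalues
    (z : OrthonormalBasis (Fin n) ℂ (EuclideanSpace ℂ (Fin n))) (μ : Fin n → ℝ)
    (hμ : Antitone μ) (hz : ∀ a, matOp H (z a) = (μ a : ℂ) • z a)
    (i s j : ℕ) (hi : 1 ≤ i) (his : i ≤ s) (hsj : s ≤ j) (hjn : j ≤ n)
    (I : SplitIteration hH.isHermitian N (orthSpan z (j - s + i) j)
      (orthSpan z (j - s) (j - s + i)) s)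
    (hyp :
      (j = s ∧ ∃ h : s < n, μ ⟨s, h⟩ < ritzValue hH.isHermitian (colSpan (I.Y 0)) s) ∨
      (∀ l, Module.finrank ℂ (colSpan (I.Y l)) = s ∧ Module.finrank ℂ (I.spaceYt l) = i ∧
        Module.finrank ℂ (I.spaceYh l) = s - i)) :
    -- (a)
    (∀ l, I.cols l = s ∧ (I.U l).rank = s ∧ i ≤ Module.finrank ℂ (I.spaceUt l)) ∧
    -- (b)
    (N = 1 → ∀ l,
      I.spaceUt l = (I.spaceYt l).map
        (matOp H : EuclideanSpace ℂ (Fin n) →ₗ[ℂ] EuclideanSpace ℂ (Fin n)) ∧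
      ∃ y ∈ I.spaceYt l, y ≠ 0 ∧
        ritzValue hH.isHermitian (Submodule.span ℂ {y, matOp H y}) 1 ≤
          ritzValue hH.isHermitian (I.spaceYt l ⊔ I.spaceUt l) i) ∧
    -- (c)
    (∀ (l : ℕ) (U Y : Matrix (Fin n) (Fin i) ℂ) (γt : ℝ),
      Uᴴ * U = 1 → colSpan U ≤ I.spaceUt l →
      Yᴴ * Y = 1 → colSpan Y = I.spaceYt l →
      (H * Y - Y * Yᴴ * H * Y).rank = i →
      ‖(H * Y - U * Uᴴ * H * Y) *
        invSqrt ((H * Y - Y * Yᴴ * H * Y)ᴴ * (H * Y - Y * Yᴴ * H * Y))‖ ≤ γt →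
      γt < 1 →
      ∃ y ∈ colSpan Y, ∃ u ∈ colSpan U, y ≠ 0 ∧ u ≠ 0 ∧
        ‖matOp H y - u‖ ≤
          γt * ‖matOp H y - (((matOp H).rayleighQuotient y : ℝ) : ℂ) • y‖ ∧
        ritzValue hH.isHermitian (Submodule.span ℂ {y, u}) 1 ≤
          ritzValue hH.isHermitian (I.spaceYt l ⊔ I.spaceUt l) i) := by
  have hN1 : ‖1 - N‖ < 1 := hNγ.trans_lt hγ
  have hdim : ∀ l, Module.finrank ℂ (colSpan (I.Y l)) = s ∧ Module.finrank ℂ (I.spaceYt l) = i ∧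
      Module.finrank ℂ (I.spaceYh l) = s - i := by
    rcases hyp with ⟨rfl, hs, hθ⟩ | h
    · have hfin : Module.finrank ℂ (colSpan (I.Y 0)) = j :=
        I.init.finrank_colSpan.trans I.cols_zero
      have hd1 := finrank_le_finrank_inf_orthSpan_add z (j - j + i) j (colSpan (I.Y 0))
      have hd2 := finrank_le_finrank_inf_orthSpan_add z (j - j) (j - j + i) (colSpan (I.Y 0))
      -- With indices from `0`, this shift is `μ_{s+1}`, the largest eigenvalue on the complement of
      -- the first `s` eigenvectors.
      refine I.finrank_eq_of_shiftedForm_pos his (ν := μ ⟨j, hs⟩) (fun v hv => ?_)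
        (fun v hv hv0 => ?_) ?_ ?_
      · have h := orthSpan_inf_orthSpan z hv
        rw [Nat.sub_self] at h
        exact shiftedForm_nonpos_of_mem_orthSpan hH.isHermitian hμ hz hs h
      · refine I.init.shiftedForm_pos ?_ hv hv0
        exact hθ.trans_eq (congrArg _ I.cols_zero.symm)
      · rw [SplitIteration.spaceYt]; omega
      · rw [SplitIteration.spaceYh]; omega
    · exact h
  have hcols : ∀ l, I.cols l = s := fun l =>
    (I.isRayleighRitz l).finrank_colSpan.symm.trans (hdim l).1
  have hrank : ∀ l, Module.finrank ℂ (colSpan (I.U l)) = s := fun l => by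
    refine (finrank_colSpan_of_injective fun c => ?_).trans (hcols l)
    exact (I.isRayleighRitz l).trialMatrix_injective hH hN1
  refine ⟨fun l => ⟨hcols l, ?_, ?_⟩, fun hN_one l => ?_, ?_⟩
  · rw [rank_eq_finrank_colSpan, hrank]
  -- Orthogonality to `s - i` eigenvectors costs at most `s - i` of the `s` dimensions.
  · have h := finrank_le_finrank_inf_orthSpan_add z (j - s + i) j (colSpan (I.U l))
    rw [hrank] at h
    rw [SplitIteration.spaceUt]
    omega
  · subst hN_one
    have hUt : I.spaceUt l = (I.spaceYt l).map
        (matOp H : EuclideanSpace ℂ (Fin n) →ₗ[ℂ] EuclideanSpace ℂ (Fin n)) := by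
      rw [SplitIteration.spaceUt, SplitIteration.U, colSpan_trialMatrix_one,
        SplitIteration.spaceYt]
      ext v
      constructor
      · rintro ⟨⟨y, hy, rfl⟩, hv⟩
        exact ⟨y, ⟨hy, (matOp_mem_orthSpan_iff hH hz).1 hv⟩, rfl⟩
      · rintro ⟨y, ⟨hy, hv⟩, rfl⟩
        exact ⟨⟨y, hy, rfl⟩, (matOp_mem_orthSpan_iff hH hz).2 hv⟩
    refine ⟨hUt, exists_ritzValue_span_pair_le_of_map_le hH.isHermitian le_sup_left
      (fun v hv => ?_) hi (hdim l).2.1⟩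
    refine Submodule.mem_sup_right ?_
    rw [hUt]
    exact ⟨v, hv, rfl⟩
  · intro l U Y γt _ hU hYY hY hR hn hγt
    exact exists_ritzValue_span_pair_le hH.isHermitian hi (hU.trans le_sup_right) hYY
      (hY.le.trans le_sup_left) hR hn hγt
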